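/- Let $A$ be a plane curve singularity of type $D_n$ with $n\ge 4$, that is, a $\mathbb C$-algebra isomorphic to $\mathbb C[[X,Y]]/\langle X(Y^2-X^{n-2})\rangle$. Let $Q(A)$ be its total ring of fractions. For a ring $A\subseteq B\subseteq Q(A)$ and an ideal $J$ of $B$ containing a non-zerodivisor of $A$, identify $\operatorname{End}_B(J)$ with $\{q\in Q(A)\mid qJ\subseteq J\}$. Let $\mathfrak m_B$ denote the Jacobson radical of $B$ (its maximal ideal if $B$ is local), and set $B'=\operatorname{End}_B(\mathfrak m_B)$. Let $n(A)$ be the number of steps of the normalization algorithm, i.e. the least $m$ with $A_m=A_{m+1}$, where $A_0=A$ and $A_{i+1}=\operatorname{End}_{A_i}(\sqrt{\mathfrak m_A A_i})$. Say that a $\mathbb C$-algebra is of type $A_k$ ($k\ge 1$) if it is isomorphic to $\mathbb C[[X,Y]]/\langle X^2-Y^{k+1}\rangle$, and of type $A_k\vee L$ (an entry of Frühbis-Krüger's list of simple space curve singularities) if it is isomorphic to the quotient of $\mathbb C[[X,Y,Z]]$ by the maximal minors of $$\begin{pmatrix} Z & Y & X^{k}\\ 0 & X & Y\end{pmatrix}.$$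 Then: 1. $A'$ is of type $A_{n-3}\vee L$. It is a transversal union of an $A_{n-3}$-singularity and a line: there are ideals $I,J$ of $\mathbb C[[X,Y,Z]]$ such that $A'\cong\mathbb C[[X,Y,Z]]/(I\cap J)$, $\mathbb C[[X,Y,Z]]/I$ is of type $A_{n-3}$, $\mathbb C[[X,Y,Z]]/J\cong\mathbb C[[t]]$, and $I+J=\langle X,Y,Z\rangle$. Moreover, $A'$ is a Noetherian local ring that is not Gorenstein. 2. If $n\ge 6$, then $A''=(A')'$ is the disjoint union of an $A_{n-5}$-singularity and a line, i.e. $A''\cong \mathbb C[[X,Y]]/\langle X^2-Y^{n-4}\rangle\times\mathbb C[[t]]$. If $n=4$ or $n=5$, then $A''$ is smooth, i.e. a regular ring. 3. $n(A)=\lfloor n/2\rfloor$. -/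

import Mathlib

universe u

/-! ### Endomorphism rings of ideals and the normalization steps

`FractionRing A` is the localization of `A` at its non-zerodivisors, that is, the total ring of
fractions `Q(A)`; `A` need not be a domain. Intermediate rings `A ⊆ B ⊆ Q(A)` are
`A`-subalgebras of `Q(A)`; the ring `A` itself is `⊥`. -/

/-- For a ring `A ⊆ B ⊆ Q(A)` and an ideal `J` of `B`, the endomorphism ring `End_B(J)`, regarded
as the ring `{q ∈ Q(A) | q J ⊆ J}`. If `J` contains a unit of `Q(A)`, then every endomorphism of
the `B`-module `J` is multiplication by a unique element of this ring,
see `existsUnique_mem_endRing`. -/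
def endRing {A : Type u} [CommRing A] (B : Subalgebra A (FractionRing A)) (J : Ideal B) :
    Subalgebra A (FractionRing A) where
  carrier := {q | ∀ x ∈ J, ∃ y ∈ J, (y : FractionRing A) = q * (x : FractionRing A)}
  mul_mem' := by
    intro p q hp hq x hx
    obtain ⟨y, hy, hyx⟩ := hq x hx
    obtain ⟨z, hz, hzy⟩ := hp y hy
    exact ⟨z, hz, by rw [hzy, hyx, mul_assoc]⟩
  add_mem' := by
    intro p q hp hq x hx
    obtain ⟨y, hy, hyx⟩ := hp x hx
    obtain ⟨z, hz, hzx⟩ := hq x hx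
    exact ⟨y + z, J.add_mem hy hz, by rw [add_mul, ← hyx, ← hzx]; rfl⟩
  algebraMap_mem' := by
    intro a x hx
    exact ⟨algebraMap A B a * x, J.mul_mem_left _ hx, rfl⟩

theorem mem_endRing {A : Type u} [CommRing A] {B : Subalgebra A (FractionRing A)} {J : Ideal B}
    {q : FractionRing A} : q ∈ endRing B J ↔
      ∀ x ∈ J, ∃ y ∈ J, (y : FractionRing A) = q * (x : FractionRing A) :=
  Iff.rfl

theorem mul_apply_comm {B : Type u} [CommRing B] {J : Ideal B} (φ : Module.End B J) (g x : J) :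
    (g : B) * (φ x : B) = (x : B) * (φ g : B) := by
  have h : (g : B) • φ x = (x : B) • φ g := by
    rw [← map_smul, ← map_smul]
    congr 1
    ext1
    exact mul_comm _ _
  exact congrArg (fun z : J => (z : B)) h

/-- The identification of `End_B(J)` with a subring of `Q(A)`. -/
theorem existsUnique_mem_endRing {A : Type u} [CommRing A] {B : Subalgebra A (FractionRing A)}
    {J : Ideal B} (g : J) (hg : IsUnit ((g : B) : FractionRing A)) (φ : Module.End B J) :
    ∃! q : FractionRing A, q ∈ endRing B J ∧
      ∀ x : J, ((φ x : B) : FractionRing A) = q * ((x : B) : FractionRing A) := by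
  obtain ⟨v, hv⟩ := hg
  have key : ∀ x : J, ((φ x : B) : FractionRing A)
      = (((φ g : B) : FractionRing A) * (↑v⁻¹ : FractionRing A))
        * ((x : B) : FractionRing A) := by
    intro x
    have h1 := mul_apply_comm φ g x
    have h2 : ((g : B) : FractionRing A) * ((φ x : B) : FractionRing A)
        = ((x : B) : FractionRing A) * ((φ g : B) : FractionRing A) :=
      congrArg (fun z : B => (z : FractionRing A)) h1
    rw [← hv] at h2
    have h3 : (v : FractionRing A) * (↑v⁻¹ : FractionRing A) = 1 := v.mul_inv
    linear_combination (↑v⁻¹ : FractionRing A) * h2 - ((φ x : B) : FractionRing A) * h3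
  refine ⟨_, ⟨fun x hx => ⟨(φ ⟨x, hx⟩ : B), (φ ⟨x, hx⟩).2, key ⟨x, hx⟩⟩, key⟩, ?_⟩
  rintro q ⟨-, hq⟩
  have h4 := hq g
  rw [← hv] at h4
  rw [h4, mul_assoc, v.mul_inv, mul_one]

/-- `B' = End_B(m_B)`, where `m_B` is the Jacobson radical of `B` (the maximal ideal, if `B` is
local). -/
def primeRing {A : Type u} [CommRing A] (B : Subalgebra A (FractionRing A)) :
    Subalgebra A (FractionRing A) :=
  endRing B (Ring.jacobson B)

/-- The chain of rings `A_0 = A`, `A_{i+1} = End_{A_i}(J_i)`, where `J_i` is the radical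
of `J A_i`. -/
def normStep {A : Type u} [CommRing A] (J : Ideal A) : ℕ → Subalgebra A (FractionRing A)
  | 0 => ⊥
  | i + 1 => endRing (normStep J i) ((J.map (algebraMap A (normStep J i))).radical)

/-- `n(A, J)`: the least `n` with `A_n = A_{n+1}`. -/
noncomputable def numSteps {A : Type u} [CommRing A] (J : Ideal A) : ℕ :=
  sInf {n | normStep J n = normStep J (n + 1)}

/-- `n(A) = n(A, m_A)` for a (non-normal) local ring `A`. -/
noncomputable def numNormSteps (A : Type u) [CommRing A] : ℕ :=
  numSteps (Ring.jacobson A)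

/-! ### Singularity types -/

/-- `ℂ[[X, Y]] / ⟨X² - Y^(k+1)⟩`. -/
abbrev SingA (k : ℕ) : Type :=
  MvPowerSeries (Fin 2) ℂ ⧸
    Ideal.span {(MvPowerSeries.X 0 ^ 2 - MvPowerSeries.X 1 ^ (k + 1) : MvPowerSeries (Fin 2) ℂ)}

/-- `ℂ[[X, Y]] / ⟨X (Y² - X^(n-2))⟩`, for `n ≥ 4`. -/
abbrev SingD (n : ℕ) : Type :=
  MvPowerSeries (Fin 2) ℂ ⧸
    Ideal.span {(MvPowerSeries.X 0 * (MvPowerSeries.X 1 ^ 2 - MvPowerSeries.X 0 ^ (n - 2)) :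
      MvPowerSeries (Fin 2) ℂ)}

/-- The ideal of maximal minors of a `2 × 3` matrix. -/
def maximalMinors {R : Type u} [CommRing R] (M : Matrix (Fin 2) (Fin 3) R) : Ideal R :=
  Ideal.span (Set.range fun f : Fin 2 → Fin 3 => (M.submatrix id f).det)

/-- The matrix with rows `(Z, Y, X^k)` and `(0, X, Y)`. -/
noncomputable def matrixAVeeL (k : ℕ) : Matrix (Fin 2) (Fin 3) (MvPowerSeries (Fin 3) ℂ) :=
  !![MvPowerSeries.X 2, MvPowerSeries.X 1, MvPowerSeries.X 0 ^ k;
     0, MvPowerSeries.X 0, MvPowerSeries.X 1]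

/-- The space curve singularity `A_k ∨ L`, given by its presentation matrix. -/
abbrev SingAVeeL (k : ℕ) : Type :=
  MvPowerSeries (Fin 3) ℂ ⧸ maximalMinors (matrixAVeeL k)

/-- `B` is a plane curve singularity of type `A_k`. -/
def IsTypeA (k : ℕ) (B : Type u) [CommRing B] [Algebra ℂ B] : Prop :=
  Nonempty (B ≃ₐ[ℂ] SingA k)

/-- `B` is a plane curve singularity of type `D_n`. -/
def IsTypeD (n : ℕ) (B : Type u) [CommRing B] [Algebra ℂ B] : Prop :=
  Nonempty (B ≃ₐ[ℂ] SingD n)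

/-- `B` is a space curve singularity of type `A_k ∨ L`. -/
def IsTypeAVeeL (k : ℕ) (B : Type u) [CommRing B] [Algebra ℂ B] : Prop :=
  Nonempty (B ≃ₐ[ℂ] SingAVeeL k)

/-- `B` is the local ring of the union, in 3-space, of a curve `V(I)` of type `A_k` and a smooth
branch `V(J)` that meets it transversally: `I + J` is the maximal ideal, which for `k ≥ 1` means
that the tangent line of `V(J)` does not lie in the Zariski tangent plane of `V(I)`. -/
def IsTransversalUnionALine (k : ℕ) (B : Type u) [CommRing B] [Algebra ℂ B] : Prop :=
  ∃ I J : Ideal (MvPowerSeries (Fin 3) ℂ),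
    Nonempty (B ≃ₐ[ℂ] MvPowerSeries (Fin 3) ℂ ⧸ (I ⊓ J)) ∧
    IsTypeA k (MvPowerSeries (Fin 3) ℂ ⧸ I) ∧
    Nonempty ((MvPowerSeries (Fin 3) ℂ ⧸ J) ≃ₐ[ℂ] PowerSeries ℂ) ∧
    I ⊔ J = IsLocalRing.maximalIdeal (MvPowerSeries (Fin 3) ℂ)

/-- `R` is a Gorenstein local ring: a Noetherian local ring of finite injective dimension
over itself. -/
def IsGorensteinLocalRing (R : Type u) [CommRing R] : Prop :=
  IsLocalRing R ∧ IsNoetherianRing R ∧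
    ∃ d : ℕ, CategoryTheory.HasInjectiveDimensionLE (ModuleCat.of R R) d

/-!
Write `n = 2(l + 1) + m + 2` with `m ≤ 1`. Putting `Y = X^(l+1) ω` on the branches `Y² = X^(n-2)`,
the normalization `T` of `A` is the disjoint union of the smooth curve `ω² = X^m` and the line
`X = 0`, with parameter `Y`. In `T`, the ring `A` consists of the pairs `(f + g ω, h)` such that
`X^(l+1)` divides `g`, `f(0) = h(0)` and the coefficient of `X^(l+1)` in `g` is `h'(0)`.

Since `T` is integral over `A`, in every ring between `A` and `T` both radicals of the normalization
algorithm are the intersection with the Jacobson radical of `T`, so each step is the computation of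
a ring of multipliers in `T`. The first step removes the condition on `h'(0)`, which gives
the space curve `A_(n-3) ∨ L`. The second one removes `f(0) = h(0)` and divides `X^(l+1)` by `X`,
which separates the line from an `A_(n-5)`-singularity. Every further step divides by `X` once more,
and `T` is reached after `l + 2` steps.

Let `x`, `y`, `z` be the coordinates on `R = A'`, with `z` the parameter of the line. The
annihilator of `z` is `(x, y)`, and `Rz` is a direct summand of the module of syzygies of `(x, y)`,
that is, of a second syzygy module of `Rz`. Finite injective dimension of `R` would therefore give
`Ext¹(Rz, R) = 0`, so every homomorphism `(x, y) → R` would be a multiplication. But on the curve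
multiplication by `Y / X` maps `x` to `y` and `y` to a multiple of `x`, and `y` is not a multiple
of `x`.
-/

open scoped nonZeroDivisors

section Conductor

variable (A : Type*) {T : Type*} [CommRing A] [CommRing T] [Algebra A T]

/-- The conductor of `A` in `T`, as an ideal of `T`: the largest ideal of `T` contained in the
image of `A`. -/
def conductorIdeal (T : Type*) [CommRing T] [Algebra A T] : Ideal T where
  carrier := {c | ∀ t, c * t ∈ (algebraMap A T).range}
  add_mem' := fun ha hb t => by rw [add_mul]; exact add_mem (ha t) (hb t)
  zero_mem' := fun t => by rw [zero_mul]; exact zero_mem _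
  smul_mem' := fun s c hc t => by rw [smul_eq_mul, mul_comm s, mul_assoc]; exact hc _

variable {A}

theorem mem_conductorIdeal {c : T} :
    c ∈ conductorIdeal A T ↔ ∀ t, c * t ∈ (algebraMap A T).range :=
  Iff.rfl

theorem mem_range_of_mem_conductorIdeal {c : T} (hc : c ∈ conductorIdeal A T) :
    c ∈ (algebraMap A T).range :=
  mul_one c ▸ hc 1

theorem algebraMap_mem_nonZeroDivisors_of_mem_conductorIdeal [FaithfulSMul A T] {c : T}
    (hc : c ∈ conductorIdeal A T) (hreg : c ∈ T⁰) {a : A} (ha : a ∈ A⁰) :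
    algebraMap A T a ∈ T⁰ := by
  rw [mem_nonZeroDivisors_iff_right] at ha hreg ⊢
  intro t ht
  obtain ⟨b, hb⟩ := hc t
  have hba : b * a = 0 := FaithfulSMul.algebraMap_injective A T <| by
    rw [map_mul, hb, mul_assoc, ht, mul_zero, map_zero]
  exact hreg t (by rw [mul_comm, ← hb, ha b hba, map_zero])

theorem mem_nonZeroDivisors_of_algebraMap_mem [FaithfulSMul A T] {a : A}
    (ha : algebraMap A T a ∈ T⁰) : a ∈ A⁰ :=
  mem_nonZeroDivisors_of_injective (FaithfulSMul.algebraMap_injective A T) ha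

theorem isFractionRing_of_mem_conductorIdeal (L : Type*) [CommRing L] [Algebra T L] [Algebra A L]
    [IsScalarTower A T L] [IsFractionRing T L] [FaithfulSMul A T] {c : T}
    (hc : c ∈ conductorIdeal A T) (hreg : c ∈ T⁰) : IsFractionRing A L where
  map_units a := by
    rw [IsScalarTower.algebraMap_apply A T L]
    exact IsLocalization.map_units L
      (⟨_, algebraMap_mem_nonZeroDivisors_of_mem_conductorIdeal hc hreg a.2⟩ : T⁰)
  surj z := by
    obtain ⟨⟨t, s⟩, hz⟩ := IsLocalization.surj T⁰ z
    obtain ⟨a, ha⟩ := hc t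
    obtain ⟨b, hb⟩ := hc s
    have hbreg : b ∈ A⁰ := mem_nonZeroDivisors_of_algebraMap_mem (hb ▸ mul_mem hreg s.2)
    refine ⟨⟨a, b, hbreg⟩, ?_⟩
    simp only [IsScalarTower.algebraMap_apply A T L, ha, hb, map_mul, ← hz]
    ring
  exists_of_eq hab := ⟨1, by
    rw [IsScalarTower.algebraMap_apply A T L, IsScalarTower.algebraMap_apply A T L] at hab
    rw [FaithfulSMul.algebraMap_injective A T (IsFractionRing.injective T L hab)]⟩

theorem exists_algHom_fractionRing [FaithfulSMul A T] {c : T} (hc : c ∈ conductorIdeal A T)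
    (hreg : c ∈ T⁰) :
    ∃ ι : T →ₐ[A] FractionRing A, Function.Injective ι ∧ ∀ v ∈ T⁰, IsUnit (ι v) := by
  have : IsFractionRing A (FractionRing T) := isFractionRing_of_mem_conductorIdeal _ hc hreg
  let e : FractionRing T ≃ₐ[A] FractionRing A := IsLocalization.algEquiv A⁰ _ _
  exact ⟨(e : FractionRing T →ₐ[A] FractionRing A).comp (IsScalarTower.toAlgHom A T _),
    e.injective.comp (IsFractionRing.injective T _),
    fun v hv => (IsLocalization.map_units (FractionRing T) (⟨v, hv⟩ : T⁰)).map e⟩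

theorem isIntegral_of_mem_radical_conductorIdeal {t : T}
    (ht : t ∈ (conductorIdeal A T).radical) : IsIntegral A t := by
  obtain ⟨k, hk⟩ := ht
  obtain ⟨a, ha⟩ := mem_range_of_mem_conductorIdeal (Ideal.mul_mem_right t _ hk)
  rw [← pow_succ] at ha
  exact IsIntegral.of_pow k.succ_pos (ha ▸ isIntegral_algebraMap)

end Conductor

section Jacobson

variable {R T : Type*} [CommRing R] [CommRing T]

theorem ringJacobson_eq_comap_of_isIntegral {f : R →+* T} (hf : Function.Injective f)
    (hint : f.IsIntegral) : Ring.jacobson R = (Ring.jacobson T).comap f := by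
  apply le_antisymm
  · intro x hx
    rw [Ideal.mem_comap, Ring.jacobson_eq_sInf_isMaximal, Submodule.mem_sInf]
    intro M (hM : Ideal.IsMaximal M)
    have := Ideal.isMaximal_comap_of_isIntegral_of_isMaximal' f hint M
    exact Ring.jacobson_le_of_isMaximal (Ideal.comap f M) hx
  · have := hint.isLocalHom hf
    intro x hx
    rw [← Ideal.jacobson_bot, Ideal.mem_jacobson_bot]
    intro y
    rw [Ideal.mem_comap, ← Ideal.jacobson_bot, Ideal.mem_jacobson_bot] at hx
    exact (isUnit_map_iff f _).1 (by simpa only [map_add, map_mul, map_one] using hx (f y))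

variable {A B : Type*} [CommRing A] [Algebra A T] [CommRing B] [Algebra A B]
  [Algebra.IsIntegral A T]

theorem ringJacobson_eq_comap_of_algHom {f : B →ₐ[A] T} (hf : Function.Injective f) :
    Ring.jacobson B = (Ring.jacobson T).comap f := by
  refine ringJacobson_eq_comap_of_isIntegral (f := (f : B →+* T)) hf ?_
  refine RingHom.IsIntegral.tower_top (algebraMap A B) _ ?_
  rw [AlgHom.comp_algebraMap]
  exact algebraMap_isIntegral_iff.2 ‹_›

theorem radical_map_jacobson_eq_jacobson [FaithfulSMul A T] {f : B →ₐ[A] T}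
    (hf : Function.Injective f) (hcond : Ring.jacobson T ≤ (conductorIdeal A T).radical) :
    ((Ring.jacobson A).map (algebraMap A B)).radical = Ring.jacobson B := by
  have hA : Ring.jacobson A = (Ring.jacobson T).comap (algebraMap A T) :=
    ringJacobson_eq_comap_of_algHom (f := Algebra.ofId A T)
      (FaithfulSMul.algebraMap_injective A T)
  rw [ringJacobson_eq_comap_of_algHom hf]
  apply le_antisymm
  · have hrad : ((Ring.jacobson T).comap f).IsRadical := by
      rw [← Ideal.jacobson_bot]
      exact (Ideal.isRadical_jacobson _).comap f
    rw [hrad.radical_le_iff, Ideal.map_le_iff_le_comap, hA]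
    intro a ha
    simpa only [Ideal.mem_comap, AlgHom.commutes] using ha
  · intro b hb
    obtain ⟨k, hk⟩ := hcond hb
    obtain ⟨a, ha⟩ := mem_range_of_mem_conductorIdeal (Ideal.mul_mem_right (f b) _ hk)
    have hab : b ^ (k + 1) = algebraMap A B a :=
      hf (by rw [AlgHom.commutes, ha, map_pow, pow_succ])
    refine ⟨k + 1, hab ▸ Ideal.mem_map_of_mem _ ?_⟩
    rw [hA, Ideal.mem_comap, ha]
    exact Ideal.mul_mem_left _ _ hb

end Jacobson

section Multiplier

variable {A T : Type*} [CommRing A] [CommRing T] [Algebra A T]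

/-- For a subalgebra `S` of `T` and an ideal `N` of `T`, the elements of `T` that multiply the ideal
`S ∩ N` of `S` into itself: the endomorphism ring of `S ∩ N`, computed inside `T`. -/
def multiplier (S : Subalgebra A T) (N : Ideal T) : Subalgebra A T where
  carrier := {t | ∀ s ∈ S, s ∈ N → t * s ∈ S}
  mul_mem' ht hu s hs hsN := by
    rw [mul_assoc]
    exact ht _ (hu s hs hsN) (N.mul_mem_left _ hsN)
  add_mem' ht hu s hs hsN := by
    rw [add_mul]
    exact S.add_mem (ht s hs hsN) (hu s hs hsN)
  algebraMap_mem' a s hs _ := S.mul_mem (S.algebraMap_mem a) hs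

theorem mem_multiplier {S : Subalgebra A T} {N : Ideal T} {t : T} :
    t ∈ multiplier S N ↔ ∀ s ∈ S, s ∈ N → t * s ∈ S :=
  Iff.rfl

theorem exists_mem_map_eq_mul_of_mem_span {L : Type*} [CommRing L] {f : T →+* L} {q : L} {s : Set T}
    {I : Ideal T} (h : ∀ x ∈ s, ∃ y ∈ I, f y = q * f x) {x : T} (hx : x ∈ Ideal.span s) :
    ∃ y ∈ I, f y = q * f x := by
  induction hx using Submodule.span_induction with
  | mem x hx => exact h x hx
  | zero => exact ⟨0, I.zero_mem, by simp only [map_zero, mul_zero]⟩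
  | add x₁ x₂ _ _ h₁ h₂ =>
    obtain ⟨y₁, hy₁, hq₁⟩ := h₁
    obtain ⟨y₂, hy₂, hq₂⟩ := h₂
    exact ⟨y₁ + y₂, I.add_mem hy₁ hy₂, by rw [map_add, map_add, mul_add, hq₁, hq₂]⟩
  | smul t x _ h =>
    obtain ⟨y, hy, hq⟩ := h
    exact ⟨t * y, I.mul_mem_left t hy, by rw [smul_eq_mul, map_mul, map_mul, hq, mul_left_comm]⟩

variable {A : Type u} [CommRing A] [Algebra A T] {ι : T →ₐ[A] FractionRing A} {S : Subalgebra A T}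
  {N : Ideal T} {J : Ideal (S.map ι)}

theorem mem_endRing_map (hJ : ∀ x : S.map ι, x ∈ J ↔ ∃ s ∈ S, s ∈ N ∧ ι s = x)
    {q : FractionRing A} : q ∈ endRing (S.map ι) J ↔
      ∀ s ∈ S, s ∈ N → ∃ s' ∈ S, s' ∈ N ∧ ι s' = q * ι s := by
  rw [mem_endRing]
  refine ⟨fun h s hs hsN => ?_, fun h x hx => ?_⟩
  · obtain ⟨y, hy, hyq⟩ := h ⟨ι s, s, hs, rfl⟩ ((hJ _).2 ⟨s, hs, hsN, rfl⟩)
    exact hyq ▸ (hJ y).1 hy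
  · obtain ⟨s, hs, hsN, hsx⟩ := (hJ x).1 hx
    obtain ⟨s', hs', hsN', hq⟩ := h s hs hsN
    exact ⟨⟨ι s', s', hs', rfl⟩, (hJ _).2 ⟨s', hs', hsN', rfl⟩, hsx ▸ hq⟩

theorem endRing_map_eq_map_multiplier (hι : Function.Injective ι)
    (hJ : ∀ x : S.map ι, x ∈ J ↔ ∃ s ∈ S, s ∈ N ∧ ι s = x) {v : T} (hv : IsUnit (ι v))
    (hspan : Ideal.span ((S : Set T) ∩ N) = Ideal.span {v}) :
    endRing (S.map ι) J = (multiplier S N).map ι := by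
  ext q
  rw [mem_endRing_map hJ, Subalgebra.mem_map]
  constructor
  · intro hq
    have hqv : ∃ y ∈ Ideal.span {v}, ι y = q * ι v := by
      refine exists_mem_map_eq_mul_of_mem_span (f := (ι : T →+* FractionRing A))
        (s := (S : Set T) ∩ N) (fun s hs => ?_) (hspan ▸ Ideal.mem_span_singleton_self v)
      obtain ⟨s', hs', hsN', hqs⟩ := hq s hs.1 hs.2
      exact ⟨s', hspan ▸ Ideal.subset_span ⟨hs', hsN'⟩, hqs⟩
    obtain ⟨y, hy, hyq⟩ := hqv
    obtain ⟨t, rfl⟩ := Ideal.mem_span_singleton'.1 hy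
    obtain rfl : ι t = q := hv.mul_right_cancel (by rw [← hyq, map_mul])
    refine ⟨t, fun s hs hsN => ?_, rfl⟩
    obtain ⟨s', hs', -, hts⟩ := hq s hs hsN
    exact hι (hts.trans (map_mul ι t s).symm) ▸ hs'
  · rintro ⟨t, ht, rfl⟩ s hs hsN
    exact ⟨t * s, ht s hs hsN, N.mul_mem_left t hsN, map_mul ι t s⟩

end Multiplier

section NormalizationChain

variable {A : Type u} {T : Type*} [CommRing A] [CommRing T] [Algebra A T]
  {ι : T →ₐ[A] FractionRing A}

/-- The embedding of `ι(S)` in `T` that is inverse to `ι`. -/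
noncomputable def mapInclusion (hι : Function.Injective ι) (S : Subalgebra A T) :
    S.map ι →ₐ[A] T :=
  S.val.comp ((S.equivMapOfInjective ι hι).symm : S.map ι →ₐ[A] S)

theorem mapInclusion_injective (hι : Function.Injective ι) (S : Subalgebra A T) :
    Function.Injective (mapInclusion hι S) :=
  Subtype.val_injective.comp (S.equivMapOfInjective ι hι).symm.injective

theorem mapInclusion_mem (hι : Function.Injective ι) {S : Subalgebra A T} (x : S.map ι) :
    mapInclusion hι S x ∈ S :=
  ((S.equivMapOfInjective ι hι).symm x).2

theorem apply_mapInclusion (hι : Function.Injective ι) {S : Subalgebra A T} (x : S.map ι) :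
    ι (mapInclusion hι S x) = x :=
  congrArg Subtype.val ((S.equivMapOfInjective ι hι).apply_symm_apply x)

variable [Algebra.IsIntegral A T]

theorem mem_jacobson_map_iff (hι : Function.Injective ι) {S : Subalgebra A T} (x : S.map ι) :
    x ∈ Ring.jacobson (S.map ι) ↔ ∃ s ∈ S, s ∈ Ring.jacobson T ∧ ι s = x := by
  rw [ringJacobson_eq_comap_of_algHom (mapInclusion_injective hι S), Ideal.mem_comap]
  refine ⟨fun h => ⟨_, mapInclusion_mem hι x, h, apply_mapInclusion hι x⟩, ?_⟩
  rintro ⟨s, -, hsN, hsx⟩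
  rwa [hι ((apply_mapInclusion hι x).trans hsx.symm)]

theorem primeRing_map_eq_map_multiplier (hι : Function.Injective ι) (S : Subalgebra A T) {v : T}
    (hv : IsUnit (ι v))
    (hspan : Ideal.span ((S : Set T) ∩ Ring.jacobson T) = Ideal.span {v}) :
    primeRing (S.map ι) = (multiplier S (Ring.jacobson T)).map ι :=
  endRing_map_eq_map_multiplier hι (mem_jacobson_map_iff hι) hv hspan

theorem normStep_succ_eq_primeRing [FaithfulSMul A T] (hι : Function.Injective ι)
    (hcond : Ring.jacobson T ≤ (conductorIdeal A T).radical) {i : ℕ} {S : Subalgebra A T}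
    (hS : normStep (Ring.jacobson A) i = S.map ι) :
    normStep (Ring.jacobson A) (i + 1) = primeRing (normStep (Ring.jacobson A) i) := by
  rw [normStep, primeRing, hS,
    radical_map_jacobson_eq_jacobson (mapInclusion_injective hι S) hcond]

theorem normStep_eq_map [FaithfulSMul A T] (hι : Function.Injective ι)
    (hcond : Ring.jacobson T ≤ (conductorIdeal A T).radical) {S : ℕ → Subalgebra A T}
    (hS : S 0 = ⊥) (hstep : ∀ i, primeRing ((S i).map ι) = (S (i + 1)).map ι) (i : ℕ) :
    normStep (Ring.jacobson A) i = (S i).map ι := by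
  induction i with
  | zero => rw [hS, Algebra.map_bot, normStep]
  | succ i ih => rw [normStep_succ_eq_primeRing hι hcond ih, ih, hstep]

theorem numNormSteps_eq [FaithfulSMul A T] (hι : Function.Injective ι)
    (hcond : Ring.jacobson T ≤ (conductorIdeal A T).radical) {S : ℕ → Subalgebra A T}
    (hS : S 0 = ⊥) (hstep : ∀ i, primeRing ((S i).map ι) = (S (i + 1)).map ι) {n : ℕ}
    (hn : S n = S (n + 1)) (hlt : ∀ i < n, S i ≠ S (i + 1)) : numNormSteps A = n := by
  have h (i : ℕ) : normStep (Ring.jacobson A) i = normStep (Ring.jacobson A) (i + 1) ↔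
      S i = S (i + 1) := by
    rw [normStep_eq_map hι hcond hS hstep, normStep_eq_map hι hcond hS hstep,
      (Subalgebra.map_injective hι).eq_iff]
  refine IsLeast.csInf_eq ⟨(h n).2 hn, fun i hi => ?_⟩
  by_contra! hin
  exact hlt i hin ((h i).1 hi)

end NormalizationChain

section Ext

open CategoryTheory Abelian

theorem subsingleton_ext_of_retract {C : Type*} [Category C] [Abelian C] [HasExt C] {X X' Y : C}
    (r : Retract X X') {i : ℕ} (h : Subsingleton (Ext X' Y i)) : Subsingleton (Ext X Y i) := by
  refine subsingleton_of_forall_eq 0 fun x => ?_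
  rw [← Ext.mk₀_id_comp x, ← r.retract, ← Ext.mk₀_comp_mk₀_assoc,
    h.elim ((Ext.mk₀ r.r).comp x (zero_add i)) 0, Ext.comp_zero]

variable {R : Type u} [CommRing R] {M N : Type u} [AddCommGroup M] [Module R M] [AddCommGroup N]
  [Module R N] {f : M →ₗ[R] N}

theorem subsingleton_ext_ker [Module.Projective R M] (hf : Function.Surjective f)
    {Y : ModuleCat.{u} R} {i : ℕ} (h : Subsingleton (Ext (ModuleCat.of R N) Y (i + 2))) :
    Subsingleton (Ext (ModuleCat.of R (LinearMap.ker f)) Y (i + 1)) := by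
  have hS := LinearMap.shortExact_shortComplexKer hf
  have : Projective (ModuleCat.of R M) := (ModuleCat.of R M).projective_of_categoryTheory_projective
  refine subsingleton_of_forall_eq 0 fun x => ?_
  obtain ⟨x₂, rfl⟩ := Ext.contravariant_sequence_exact₁ hS Y x (n₁ := i + 2) (by lia) (h.elim _ _)
  have hx₂ : x₂ = 0 := Ext.eq_zero_of_projective (P := ModuleCat.of R M) x₂
  rw [hx₂, Ext.comp_zero]

theorem exists_extension_of_subsingleton_ext_one {Y : Type u} [AddCommGroup Y] [Module R Y]
    (hf : Function.Surjective f)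
    (h : Subsingleton (Ext (ModuleCat.of R N) (ModuleCat.of R Y) 1))
    (φ : LinearMap.ker f →ₗ[R] Y) : ∃ ψ : M →ₗ[R] Y, ∀ x : LinearMap.ker f, ψ x = φ x := by
  have hS := LinearMap.shortExact_shortComplexKer hf
  obtain ⟨x₂, hx₂⟩ := Ext.contravariant_sequence_exact₁ hS (ModuleCat.of R Y)
    (Ext.mk₀ (ModuleCat.ofHom φ)) (n₁ := 1) rfl (h.elim _ _)
  obtain ⟨ψ, rfl⟩ := (Ext.mk₀_bijective _ _).2 x₂
  rw [Ext.mk₀_comp_mk₀] at hx₂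
  have hψ := (Ext.mk₀_bijective _ _).1 hx₂
  exact ⟨ψ.hom, fun x => congrArg (fun g => g.hom x) hψ⟩

theorem subsingleton_ext_one_of_retract_second_syzygy [Module.Projective R M] {M' : Type u}
    [AddCommGroup M'] [Module R M'] [Module.Projective R M'] (hf : Function.Surjective f)
    {f' : M' →ₗ[R] LinearMap.ker f} (hf' : Function.Surjective f')
    (r : Retract (ModuleCat.of R N) (ModuleCat.of R (LinearMap.ker f'))) (Y : ModuleCat.{u} R)
    (d : ℕ) [HasInjectiveDimensionLE Y d] : Subsingleton (Ext (ModuleCat.of R N) Y 1) := by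
  suffices h : ∀ k, Subsingleton (Ext (ModuleCat.of R N) Y (2 * k + 1)) →
      Subsingleton (Ext (ModuleCat.of R N) Y 1) from
    h d (HasInjectiveDimensionLT.subsingleton.{u} Y (d + 1) (2 * d + 1) (by lia) _)
  intro k
  induction k with
  | zero => exact id
  | succ k ih =>
    exact fun h => ih <| subsingleton_ext_of_retract r <|
      subsingleton_ext_ker hf' (subsingleton_ext_ker hf (i := 2 * k + 1) h)

end Ext

section LinearMap

variable {R M N : Type*} [CommRing R] [AddCommGroup M] [Module R M] [AddCommGroup N] [Module R N]

theorem exists_comp_eq_of_ker_le_ker {P : Type*} [AddCommGroup P] [Module R P] {f : M →ₗ[R] N}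
    (hf : Function.Surjective f) {g : M →ₗ[R] P} (h : LinearMap.ker f ≤ LinearMap.ker g) :
    ∃ φ : N →ₗ[R] P, φ ∘ₗ f = g := by
  refine ⟨(LinearMap.ker f).liftQ g h ∘ₗ (f.quotKerEquivOfSurjective hf).symm,
    LinearMap.ext fun m => ?_⟩
  have hm : (f.quotKerEquivOfSurjective hf).symm (f m) = (LinearMap.ker f).mkQ m :=
    (LinearEquiv.symm_apply_eq _).2 rfl
  rw [LinearMap.comp_apply, LinearMap.comp_apply, LinearEquiv.coe_coe, hm, Submodule.mkQ_apply,
    Submodule.liftQ_apply]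

theorem exists_comp_eq_id_of_disjoint {p q : Submodule R N} (hpq : Disjoint p q) {g : M →ₗ[R] N}
    (hg : LinearMap.range g ≤ p ⊔ q) {i : p →ₗ[R] M} (hi : g ∘ₗ i = p.subtype) :
    ∃ ρ : M →ₗ[R] p, ρ ∘ₗ i = LinearMap.id := by
  let j : p →ₗ[R] N ⧸ q := q.mkQ ∘ₗ p.subtype
  have hj : Function.Injective j := by
    rw [← LinearMap.ker_eq_bot, LinearMap.ker_comp, Submodule.ker_mkQ]
    exact Submodule.disjoint_iff_comap_eq_bot.1 hpq
  have hrange (m : M) : q.mkQ (g m) ∈ LinearMap.range j := by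
    obtain ⟨a, ha, b, hb, hab⟩ := Submodule.mem_sup.1 (hg ⟨m, rfl⟩)
    refine ⟨⟨a, ha⟩, ((Submodule.Quotient.eq q).2 ?_).symm⟩
    rwa [← hab, Submodule.coe_subtype, add_sub_cancel_left]
  refine ⟨(LinearEquiv.ofInjective j hj).symm ∘ₗ (q.mkQ ∘ₗ g).codRestrict _ hrange,
    LinearMap.ext fun t => ?_⟩
  rw [LinearMap.comp_apply, LinearMap.comp_apply, LinearEquiv.coe_coe, LinearEquiv.symm_apply_eq]
  exact Subtype.ext (congrArg q.mkQ (LinearMap.congr_fun hi t))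

end LinearMap

section SpanPair

variable {R : Type u} [CommRing R] {x y z y' : R}

theorem exists_comp_eq_id_of_mem_ker_iff {N : Type*} [AddCommGroup N] [Module R N]
    {f : R × R →ₗ[R] N} (hf : ∀ p, p ∈ LinearMap.ker f ↔ p.1 * x + p.2 * y = 0) (hzx : z * x = 0)
    (hdisj : Disjoint (Ideal.span {z}) (Ideal.span {x, y}))
    (hsyz : ∀ a b, a * x + b * y = 0 → a ∈ Ideal.span {z} ⊔ Ideal.span {x, y}) :
    ∃ (i : Ideal.span {z} →ₗ[R] LinearMap.ker f) (ρ : LinearMap.ker f →ₗ[R] Ideal.span {z}),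
      ρ ∘ₗ i = LinearMap.id := by
  have hi (t : Ideal.span {z}) : ((t : R), (0 : R)) ∈ LinearMap.ker f := by
    obtain ⟨r, hr⟩ := Ideal.mem_span_singleton'.1 t.2
    rw [hf, ← hr, mul_assoc, hzx, mul_zero, zero_mul, add_zero]
  refine ⟨(LinearMap.inl R R R ∘ₗ (Ideal.span {z}).subtype).codRestrict _ hi,
    exists_comp_eq_id_of_disjoint hdisj (g := LinearMap.fst R R R ∘ₗ (LinearMap.ker f).subtype)
      ?_ rfl⟩
  rintro _ ⟨⟨p, hp⟩, rfl⟩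
  exact hsyz p.1 p.2 ((hf p).1 hp)

theorem not_hasInjectiveDimensionLE_of_annihilator_eq_span_pair
    (hann : ∀ r, r * z = 0 ↔ r ∈ Ideal.span {x, y})
    (hdisj : Disjoint (Ideal.span {z}) (Ideal.span {x, y}))
    (hsyz : ∀ a b, a * x + b * y = 0 → a ∈ Ideal.span {z} ⊔ Ideal.span {x, y})
    (hmap : ∀ a b, a * x + b * y = 0 → a * y + b * y' = 0) (hy : ¬ x ∣ y) (d : ℕ) :
    ¬ CategoryTheory.HasInjectiveDimensionLE (ModuleCat.of R R) d := by
  intro hd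
  let f : R →ₗ[R] Ideal.span {z} := (LinearMap.toSpanSingleton R R z).codRestrict _ fun r =>
    Ideal.mul_mem_left _ r (Ideal.mem_span_singleton_self z)
  have hf : Function.Surjective f := fun ⟨t, ht⟩ =>
    (Ideal.mem_span_singleton'.1 ht).imp fun r hr => Subtype.ext hr
  have hker (r : R) : r ∈ LinearMap.ker f ↔ r ∈ Ideal.span {x, y} := by
    rw [← hann, LinearMap.mem_ker, ← Subtype.coe_inj]
    rfl
  let f' : R × R →ₗ[R] LinearMap.ker f :=
    ((LinearMap.toSpanSingleton R R x).coprod (LinearMap.toSpanSingleton R R y)).codRestrict _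
      fun p => (hker _).2 (Ideal.mem_span_pair.2 ⟨p.1, p.2, rfl⟩)
  have hf' : Function.Surjective f' := fun ⟨r, hr⟩ => by
    obtain ⟨a, b, hab⟩ := Ideal.mem_span_pair.1 ((hker r).1 hr)
    exact ⟨(a, b), Subtype.ext hab⟩
  have hker' (p : R × R) : p ∈ LinearMap.ker f' ↔ p.1 * x + p.2 * y = 0 := by
    rw [LinearMap.mem_ker, ← Subtype.coe_inj]
    rfl
  have hext : Subsingleton (CategoryTheory.Abelian.Ext (ModuleCat.of R (Ideal.span {z}))
      (ModuleCat.of R R) 1) := by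
    have hzx : z * x = 0 := mul_comm x z ▸ (hann x).2 (Ideal.subset_span (Set.mem_insert _ _))
    obtain ⟨i, ρ, hρ⟩ := exists_comp_eq_id_of_mem_ker_iff hker' hzx hdisj hsyz
    exact subsingleton_ext_one_of_retract_second_syzygy hf hf'
      ⟨ModuleCat.ofHom i, ModuleCat.ofHom ρ, by rw [← ModuleCat.ofHom_comp, hρ]; rfl⟩ _ d
  obtain ⟨φ, hφ⟩ := exists_comp_eq_of_ker_le_ker hf' (g := (LinearMap.toSpanSingleton R R y).coprod
    (LinearMap.toSpanSingleton R R y')) fun p hp => hmap _ _ ((hker' p).1 hp)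
  obtain ⟨ψ, hψ⟩ := exists_extension_of_subsingleton_ext_one hf hext φ
  have hφy : φ (f' (1, 0)) = y := (LinearMap.congr_fun hφ (1, 0)).trans (by simp)
  have hx : ((f' (1, 0) : LinearMap.ker f) : R) = x • (1 : R) := by
    change (1 : R) * x + 0 * y = x * 1
    ring
  exact hy ⟨ψ 1, by rw [← hφy, ← hψ, hx, map_smul, smul_eq_mul]⟩

end SpanPair

theorem not_hasInjectiveDimensionLE_of_ringEquiv {R : Type u} {S : Type*} [CommRing R] [CommRing S]
    (e : R ≃+* S) {x y z y' : S} (hann : ∀ r, r * z = 0 ↔ r ∈ Ideal.span {x, y})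
    (hdisj : Disjoint (Ideal.span {z}) (Ideal.span {x, y}))
    (hsyz : ∀ a b, a * x + b * y = 0 → a ∈ Ideal.span {z} ⊔ Ideal.span {x, y})
    (hmap : ∀ a b, a * x + b * y = 0 → a * y + b * y' = 0) (hy : ¬ x ∣ y) (d : ℕ) :
    ¬ CategoryTheory.HasInjectiveDimensionLE (ModuleCat.of R R) d := by
  have hxy : Ideal.span {e.symm x, e.symm y} = (Ideal.span {x, y}).map e.symm := by
    rw [Ideal.map_span, Set.image_pair]
  have hz : Ideal.span {e.symm z} = (Ideal.span {z}).map e.symm := by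
    rw [Ideal.map_span, Set.image_singleton]
  have hsyz_map (a b : R) : a * e.symm x + b * e.symm y = 0 ↔ e a * x + e b * y = 0 := by
    rw [← map_eq_zero_iff e e.injective]
    simp only [map_add, map_mul, RingEquiv.apply_symm_apply]
  refine not_hasInjectiveDimensionLE_of_annihilator_eq_span_pair (x := e.symm x) (y := e.symm y)
    (z := e.symm z) (y' := e.symm y') (fun r => ?_) ?_ (fun a b hab => ?_) (fun a b hab => ?_) ?_ d
  · rw [hxy, Ideal.map_symm, Ideal.mem_comap, ← hann,
      ← map_eq_zero_iff e e.injective, map_mul, RingEquiv.apply_symm_apply]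
  · rw [hxy, hz, Ideal.map_symm, Ideal.map_symm, disjoint_iff, ← Ideal.comap_inf,
      disjoint_iff.1 hdisj]
    exact Ideal.comap_bot_of_injective _ e.injective
  · rw [hxy, hz, ← Ideal.map_sup, Ideal.map_symm]
    exact hsyz _ _ ((hsyz_map a b).1 hab)
  · apply e.injective
    simpa using hmap _ _ ((hsyz_map a b).1 hab)
  · rwa [map_dvd_iff]

section DoubleCover

open PowerSeries

/-- The curve `ω² = X^m`, as a free module over `K⟦X⟧` with basis `1, ω`. -/
abbrev DoubleCover (K : Type*) [CommRing K] (m : ℕ) : Type _ :=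
  QuadraticAlgebra K⟦X⟧ ((X : K⟦X⟧) ^ m) 0

/-- The disjoint union of the curve `ω² = X^m` and a line. For `m = 0` (two branches) and `m = 1`
(one branch) it is smooth if `2` is invertible, and it is the normalization of the singularities of
type `D`. -/
abbrev DoubleCoverLine (K : Type*) [CommRing K] (m : ℕ) : Type _ :=
  DoubleCover K m × K⟦X⟧

variable {K : Type*} [Field K] {m : ℕ}

theorem isUnit_doubleCover_iff {z : DoubleCover K m} :
    IsUnit z ↔ (constantCoeff z.re + constantCoeff (X ^ m * z.im)) *
      (constantCoeff z.re - constantCoeff (X ^ m * z.im)) ≠ 0 := by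
  have hzero : (0 ^ m * 0 ^ m : K) = 0 ^ m := by rcases m with _ | m <;> simp
  rw [QuadraticAlgebra.isUnit_iff_norm_isUnit, isUnit_iff_constantCoeff, isUnit_iff_ne_zero]
  refine not_congr (Eq.congr_left ?_)
  simp only [QuadraticAlgebra.norm_def, map_sub, map_add, map_mul, map_pow, constantCoeff_X,
    map_zero]
  linear_combination constantCoeff z.im ^ 2 * hzero

theorem mem_jacobson_doubleCover [NeZero (2 : K)] {z : DoubleCover K m} :
    z ∈ Ring.jacobson (DoubleCover K m) ↔ X ∣ z.re ∧ X ∣ X ^ m * z.im := by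
  rw [← Ideal.jacobson_bot, Ideal.mem_jacobson_bot, X_dvd_iff, X_dvd_iff]
  constructor
  · intro h
    have hunit (c : K) : (c * (constantCoeff z.re + constantCoeff (X ^ m * z.im)) + 1) *
        (c * (constantCoeff z.re - constantCoeff (X ^ m * z.im)) + 1) ≠ 0 := by
      have hc := isUnit_doubleCover_iff.1 (h (algebraMap K⟦X⟧ _ (C c)))
      convert hc using 2 <;>
        simp [QuadraticAlgebra.re_one, QuadraticAlgebra.im_one] <;> ring
    have eq_zero_of_forall {s : K} (hs : ∀ c, c * s + 1 ≠ 0) : s = 0 := by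
      by_contra hne
      exact hs (-s⁻¹) (by rw [neg_mul, inv_mul_cancel₀ hne, neg_add_cancel])
    have hadd := eq_zero_of_forall fun c => left_ne_zero_of_mul (hunit c)
    have hsub := eq_zero_of_forall fun c => right_ne_zero_of_mul (hunit c)
    constructor <;> refine (mul_eq_zero_iff_left (NeZero.ne (2 : K))).1 ?_
    · linear_combination hadd + hsub
    · linear_combination hadd - hsub
  · rintro ⟨hre, him⟩ w
    have him' : 0 ^ m * constantCoeff z.im = 0 := by
      simpa only [map_mul, map_pow, constantCoeff_X] using him
    rw [isUnit_doubleCover_iff]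
    have hre' : constantCoeff (z * w + 1).re = 1 := by
      simp only [QuadraticAlgebra.re_add, QuadraticAlgebra.re_mul, QuadraticAlgebra.re_one,
        map_add, map_mul, map_one, hre, map_pow, constantCoeff_X, him', zero_mul, zero_add]
    have him'' : constantCoeff (X ^ m * (z * w + 1).im) = 0 := by
      simp only [QuadraticAlgebra.im_add, QuadraticAlgebra.im_mul, QuadraticAlgebra.im_one,
        map_add, map_mul, map_zero, hre, map_pow, constantCoeff_X]
      linear_combination constantCoeff w.re * him'
    rw [hre', him'', add_zero, sub_zero, one_mul]
    exact one_ne_zero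

theorem mem_jacobson_prod {R S : Type*} [CommRing R] [CommRing S] {x : R × S} :
    x ∈ Ring.jacobson (R × S) ↔ x.1 ∈ Ring.jacobson R ∧ x.2 ∈ Ring.jacobson S := by
  simp only [← Ideal.jacobson_bot, Ideal.mem_jacobson_bot, Prod.isUnit_iff, Prod.forall,
    Prod.fst_add, Prod.fst_mul, Prod.fst_one, Prod.snd_add, Prod.snd_mul, Prod.snd_one]
  exact ⟨fun h => ⟨fun r => (h r 0).1, fun s => (h 0 s).2⟩, fun h r s => ⟨h.1 r, h.2 s⟩⟩

theorem mem_jacobson_doubleCoverLine [NeZero (2 : K)] {x : DoubleCoverLine K m} :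
    x ∈ Ring.jacobson (DoubleCoverLine K m) ↔ X ∣ x.1.re ∧ X ∣ X ^ m * x.1.im ∧ X ∣ x.2 := by
  rw [mem_jacobson_prod, mem_jacobson_doubleCover, IsLocalRing.ringJacobson_eq_maximalIdeal,
    maximalIdeal_eq_span_X, Ideal.mem_span_singleton, and_assoc]

theorem algebraMap_X_dvd_iff {x : DoubleCoverLine K m} :
    algebraMap K⟦X⟧ (DoubleCoverLine K m) X ∣ x ↔ X ∣ x.1.re ∧ X ∣ x.1.im ∧ X ∣ x.2 := by
  rw [Prod.algebraMap_apply, prod_dvd_iff, QuadraticAlgebra.algebraMap_dvd_iff, and_assoc]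
  rfl

theorem algebraMap_X_mem_nonZeroDivisors :
    algebraMap K⟦X⟧ (DoubleCoverLine K m) X ∈ (DoubleCoverLine K m)⁰ := by
  rw [mem_nonZeroDivisors_iff_right]
  rintro x hx
  rw [mul_comm, ← Algebra.smul_def] at hx
  exact (smul_eq_zero_iff_right X_ne_zero).1 hx

end DoubleCover

section PartialNormalizations

open PowerSeries

theorem coeff_mul_of_X_pow_dvd {R : Type*} [CommSemiring R] {l : ℕ} (f : R⟦X⟧) {g : R⟦X⟧}
    (hg : X ^ l ∣ g) : coeff l (f * g) = constantCoeff f * coeff l g := by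
  obtain ⟨g, rfl⟩ := hg
  rw [mul_left_comm, coeff_X_pow_mul', coeff_X_pow_mul', Nat.sub_self]
  simp only [coeff_zero_eq_constantCoeff, map_mul, le_refl, if_true]

variable (K : Type*) [CommRing K] (m l : ℕ)

/-- The disjoint union of the curve `Y² = X^(2l+m)` and a line, where `Y = X^l ω`. -/
def disjointUnion : Subalgebra K (DoubleCoverLine K m) where
  carrier := {x | X ^ l ∣ x.1.im}
  mul_mem' {x y} hx hy := by
    change X ^ l ∣ (x.1 * y.1).im
    rw [QuadraticAlgebra.im_mul, zero_mul, zero_mul, add_zero]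
    exact dvd_add (dvd_mul_of_dvd_right hy _) (dvd_mul_of_dvd_left hx _)
  add_mem' hx hy := dvd_add hx hy
  algebraMap_mem' _ := dvd_zero _

/-- The union in 3-space of the curve `Y² = X^(2(l+1)+m)`, where `Y = X^(l+1) ω`, and a transversal
line. -/
def spatialUnion : Subalgebra K (DoubleCoverLine K m) where
  carrier := {x | X ^ (l + 1) ∣ x.1.im ∧ constantCoeff x.1.re = constantCoeff x.2}
  mul_mem' {x y} hx hy := by
    refine ⟨(disjointUnion K m (l + 1)).mul_mem hx.1 hy.1, ?_⟩
    have him : constantCoeff x.1.im = 0 :=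
      X_dvd_iff.1 ((dvd_pow_self X l.succ_ne_zero).trans hx.1)
    simp only [Prod.fst_mul, Prod.snd_mul, QuadraticAlgebra.re_mul, map_add, map_mul, him, hx.2,
      hy.2, mul_zero, zero_mul, add_zero]
  add_mem' {x y} hx hy := by
    refine ⟨dvd_add hx.1 hy.1, ?_⟩
    simp only [Prod.fst_add, Prod.snd_add, QuadraticAlgebra.re_add, map_add, hx.2, hy.2]
  algebraMap_mem' _ := ⟨dvd_zero _, rfl⟩

/-- The union in the plane of the curve `Y² = X^(2(l+1)+m)`, where `Y = X^(l+1) ω`, and the line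
`X = 0`, whose coordinate is `Y`. -/
def planarUnion : Subalgebra K (DoubleCoverLine K m) where
  carrier := {x | x ∈ spatialUnion K m l ∧ coeff (l + 1) x.1.im = coeff 1 x.2}
  mul_mem' {x y} hx hy := by
    refine ⟨(spatialUnion K m l).mul_mem hx.1 hy.1, ?_⟩
    simp only [Prod.fst_mul, Prod.snd_mul, QuadraticAlgebra.im_mul, zero_mul, add_zero, map_add]
    rw [coeff_mul_of_X_pow_dvd _ hy.1.1, mul_comm x.1.im, coeff_mul_of_X_pow_dvd _ hx.1.1,
      coeff_one_mul, hx.2, hy.2, hx.1.2, hy.1.2]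
    ring
  add_mem' {x y} hx hy := by
    refine ⟨(spatialUnion K m l).add_mem hx.1 hy.1, ?_⟩
    simp only [Prod.fst_add, Prod.snd_add, QuadraticAlgebra.im_add, map_add, hx.2, hy.2]
  algebraMap_mem' c := by
    refine ⟨(spatialUnion K m l).algebraMap_mem c, ?_⟩
    change coeff (l + 1) 0 = coeff 1 (C c)
    rw [coeff_C, if_neg one_ne_zero, map_zero]

variable {K m l} {x : DoubleCoverLine K m}

theorem mem_disjointUnion : x ∈ disjointUnion K m l ↔ X ^ l ∣ x.1.im :=
  Iff.rfl

theorem mem_planarUnion : x ∈ planarUnion K m l ↔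
    x ∈ spatialUnion K m l ∧ coeff (l + 1) x.1.im = coeff 1 x.2 :=
  Iff.rfl

theorem disjointUnion_zero : disjointUnion K m 0 = ⊤ :=
  top_unique fun x _ => by rw [mem_disjointUnion, pow_zero]; exact one_dvd _

theorem disjointUnion_antitone : Antitone (disjointUnion K m) :=
  fun _ _ h _ hx => (pow_dvd_pow X h).trans hx

variable (K m l)

theorem planarUnion_le_spatialUnion : planarUnion K m l ≤ spatialUnion K m l :=
  fun _ hx => hx.1

theorem spatialUnion_le_disjointUnion : spatialUnion K m l ≤ disjointUnion K m (l + 1) :=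
  fun _ hx => hx.1

theorem planarUnion_ne_spatialUnion [Nontrivial K] : planarUnion K m l ≠ spatialUnion K m l := by
  intro h
  have hmem : ((0, X) : DoubleCoverLine K m) ∈ spatialUnion K m l :=
    ⟨dvd_zero _, by simp only [QuadraticAlgebra.re_zero, map_zero, constantCoeff_X]⟩
  rw [← h] at hmem
  simpa using hmem.2

theorem spatialUnion_ne_disjointUnion [Nontrivial K] {k : ℕ} :
    spatialUnion K m l ≠ disjointUnion K m k := by
  intro h
  have hmem : ((1, 0) : DoubleCoverLine K m) ∈ disjointUnion K m k := dvd_zero _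
  rw [← h] at hmem
  simpa [QuadraticAlgebra.re_one] using hmem.2

theorem disjointUnion_injective [Nontrivial K] : Function.Injective (disjointUnion K m) := by
  have le_of_le {k l : ℕ} (h : disjointUnion K m k ≤ disjointUnion K m l) : l ≤ k := by
    have hmem : ((⟨0, X ^ k⟩, 0) : DoubleCoverLine K m) ∈ disjointUnion K m l :=
      h (mem_disjointUnion.2 dvd_rfl)
    by_contra! hlt
    simpa using X_pow_dvd_iff.1 hmem k hlt
  exact fun k l h => le_antisymm (le_of_le h.ge) (le_of_le h.le)

end PartialNormalizations

section Multipliers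

open PowerSeries

variable {K : Type*} [Field K] {m l : ℕ}

theorem mk_X_zero_mem_planarUnion :
    ((⟨X, 0⟩, 0) : DoubleCoverLine K m) ∈ planarUnion K m l := by
  refine ⟨⟨dvd_zero _, ?_⟩, ?_⟩
  · exact constantCoeff_X.trans (map_zero _).symm
  · exact (map_zero _).trans (map_zero _).symm

theorem mk_X_pow_X_mem_planarUnion :
    ((⟨0, X ^ (l + 1)⟩, X) : DoubleCoverLine K m) ∈ planarUnion K m l := by
  refine ⟨⟨dvd_rfl, ?_⟩, ?_⟩
  · exact (map_zero _).trans constantCoeff_X.symm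
  · exact (coeff_X_pow_self _).trans coeff_one_X.symm

theorem omega_X_mem_nonZeroDivisors :
    ((QuadraticAlgebra.omega, X) : DoubleCoverLine K 1) ∈ (DoubleCoverLine K 1)⁰ := by
  have h : algebraMap K⟦X⟧ (DoubleCoverLine K 1) X =
      (QuadraticAlgebra.omega, X) * (QuadraticAlgebra.omega, 1) := by
    ext <;> simp
  exact (mul_mem_nonZeroDivisors.1 (h ▸ algebraMap_X_mem_nonZeroDivisors)).1

variable [NeZero (2 : K)]

theorem mk_X_zero_mem_jacobson :
    ((⟨X, 0⟩, 0) : DoubleCoverLine K m) ∈ Ring.jacobson (DoubleCoverLine K m) :=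
  mem_jacobson_doubleCoverLine.2 ⟨dvd_rfl, dvd_mul_of_dvd_right (dvd_zero X) _, dvd_zero X⟩

theorem mk_X_pow_X_mem_jacobson :
    ((⟨0, X ^ (l + 1)⟩, X) : DoubleCoverLine K m) ∈ Ring.jacobson (DoubleCoverLine K m) :=
  mem_jacobson_doubleCoverLine.2
    ⟨dvd_zero X, dvd_mul_of_dvd_right (dvd_pow_self X l.succ_ne_zero) _, dvd_rfl⟩

theorem multiplier_planarUnion :
    multiplier (planarUnion K m l) (Ring.jacobson _) = spatialUnion K m l := by
  ext t
  rw [mem_multiplier]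
  constructor
  · intro h
    obtain ⟨⟨him, -⟩, hcoeff⟩ := h _ mk_X_zero_mem_planarUnion mk_X_zero_mem_jacobson
    obtain ⟨-, hlin⟩ := h _ mk_X_pow_X_mem_planarUnion mk_X_pow_X_mem_jacobson
    simp only [Prod.fst_mul, Prod.snd_mul, QuadraticAlgebra.im_mul, zero_mul, mul_zero, zero_add,
      add_zero, map_zero, coeff_succ_mul_X] at him hcoeff
    simp only [Prod.fst_mul, Prod.snd_mul, QuadraticAlgebra.im_mul, zero_mul, mul_zero,
      add_zero, coeff_one_mul, coeff_mul_of_X_pow_dvd _ (dvd_refl ((X : K⟦X⟧) ^ (l + 1))),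
      coeff_X_pow_self, coeff_one_X, constantCoeff_X, one_mul, mul_one, zero_add] at hlin
    refine ⟨X_pow_dvd_iff.2 fun i hi => ?_, hlin⟩
    obtain hi | rfl := (Nat.lt_succ_iff.1 hi).lt_or_eq
    · rw [← coeff_succ_mul_X]
      exact X_pow_dvd_iff.1 him _ (Nat.succ_lt_succ hi)
    · exact hcoeff
  · rintro ht s ⟨hs, hs'⟩ hsN
    obtain ⟨hre, -, hline⟩ := mem_jacobson_doubleCoverLine.1 hsN
    refine ⟨mul_mem ht hs, ?_⟩
    simp only [Prod.fst_mul, Prod.snd_mul, QuadraticAlgebra.im_mul, zero_mul, add_zero, map_add]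
    rw [coeff_mul_of_X_pow_dvd _ hs.1, mul_comm t.1.im, coeff_mul_of_X_pow_dvd _ ht.1,
      coeff_one_mul, X_dvd_iff.1 hre, X_dvd_iff.1 hline, hs', ht.2]
    ring

theorem multiplier_spatialUnion :
    multiplier (spatialUnion K m l) (Ring.jacobson _) = disjointUnion K m l := by
  ext t
  rw [mem_multiplier]
  constructor
  · intro h
    obtain ⟨him, -⟩ :=
      h _ (planarUnion_le_spatialUnion K m l mk_X_zero_mem_planarUnion) mk_X_zero_mem_jacobson
    simpa only [mem_disjointUnion, Prod.fst_mul, QuadraticAlgebra.im_mul, zero_mul, mul_zero,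
      zero_add, add_zero, pow_succ, mul_dvd_mul_iff_right (X_ne_zero (R := K))] using him
  · intro ht s hs hsN
    obtain ⟨hre, him, hline⟩ := mem_jacobson_doubleCoverLine.1 hsN
    rw [X_dvd_iff] at hre him hline
    refine ⟨?_, ?_⟩
    · simp only [Prod.fst_mul, QuadraticAlgebra.im_mul, zero_mul, add_zero]
      exact dvd_add (dvd_mul_of_dvd_right hs.1 _) (mul_dvd_mul ht (X_dvd_iff.2 hre))
    · rw [map_mul] at him
      simp only [Prod.fst_mul, Prod.snd_mul, QuadraticAlgebra.re_mul, map_add, map_mul, hre, hline,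
        mul_right_comm _ (constantCoeff t.1.im), him, mul_zero, zero_mul, add_zero]

theorem multiplier_disjointUnion :
    multiplier (disjointUnion K m l) (Ring.jacobson _) = disjointUnion K m (l - 1) := by
  ext t
  rw [mem_multiplier]
  rcases l with _ | l
  · simp only [Nat.zero_sub, disjointUnion_zero, Algebra.mem_top, implies_true]
  · rw [Nat.add_sub_cancel]
    constructor
    · intro h
      have him := h _ (spatialUnion_le_disjointUnion K m l <|
        planarUnion_le_spatialUnion K m l mk_X_zero_mem_planarUnion) mk_X_zero_mem_jacobson
      simpa only [mem_disjointUnion, Prod.fst_mul, QuadraticAlgebra.im_mul, zero_mul, mul_zero,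
        zero_add, add_zero, pow_succ, mul_dvd_mul_iff_right (X_ne_zero (R := K))] using him
    · intro ht s hs hsN
      have hre := (mem_jacobson_doubleCoverLine.1 hsN).1
      simp only [mem_disjointUnion, Prod.fst_mul, QuadraticAlgebra.im_mul, zero_mul, add_zero]
      exact dvd_add (dvd_mul_of_dvd_right hs _) (mul_dvd_mul ht hre)

theorem span_inter_jacobson_eq_span_X {S : Subalgebra K (DoubleCoverLine K m)}
    (hS : planarUnion K m l ≤ S) (hm : m = 0 ∨ S ≤ disjointUnion K m 1) :
    Ideal.span ((S : Set (DoubleCoverLine K m)) ∩ Ring.jacobson (DoubleCoverLine K m)) =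
      Ideal.span {algebraMap K⟦X⟧ (DoubleCoverLine K m) X} := by
  apply le_antisymm
  · rw [Ideal.span_le]
    rintro s ⟨hs, hsN⟩
    obtain ⟨hre, him, hline⟩ := mem_jacobson_doubleCoverLine.1 hsN
    rw [SetLike.mem_coe, Ideal.mem_span_singleton, algebraMap_X_dvd_iff]
    refine ⟨hre, ?_, hline⟩
    rcases hm with rfl | hm
    · simpa only [pow_zero, one_mul] using him
    · simpa only [pow_one] using mem_disjointUnion.1 (hm hs)
  · rw [Ideal.span_singleton_le_iff_mem]
    have hsum : algebraMap K⟦X⟧ (DoubleCoverLine K m) X =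
        (⟨X, 0⟩, 0) + (0, 1) * (⟨0, X ^ (l + 1)⟩, X) := by
      ext <;> simp
    rw [hsum]
    exact add_mem
      (Ideal.subset_span ⟨hS mk_X_zero_mem_planarUnion, mk_X_zero_mem_jacobson⟩)
      (Ideal.mul_mem_left _ _
        (Ideal.subset_span ⟨hS mk_X_pow_X_mem_planarUnion, mk_X_pow_X_mem_jacobson⟩))

theorem jacobson_doubleCoverLine_one_eq_span :
    Ring.jacobson (DoubleCoverLine K 1) =
      Ideal.span {(QuadraticAlgebra.omega, (X : K⟦X⟧))} := by
  ext ⟨⟨a, b⟩, g⟩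
  simp only [mem_jacobson_doubleCoverLine, Ideal.mem_span_singleton, pow_one, dvd_mul_right,
    true_and, prod_dvd_iff]
  refine and_congr_left' ⟨?_, ?_⟩
  · rintro ⟨c, rfl⟩
    exact ⟨⟨b, c⟩, by simp [QuadraticAlgebra.omega_mul_mk]⟩
  · rintro ⟨⟨c, d⟩, h⟩
    rw [QuadraticAlgebra.omega_mul_mk, pow_one] at h
    exact ⟨d, congrArg QuadraticAlgebra.re h⟩

theorem exists_span_inter_jacobson_eq (hm : m ≤ 1) {S : Subalgebra K (DoubleCoverLine K m)}
    (hS : planarUnion K m l ≤ S) (hS' : S ≤ disjointUnion K m 1 ∨ S = ⊤) :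
    ∃ v ∈ (DoubleCoverLine K m)⁰, Ideal.span ((S : Set (DoubleCoverLine K m)) ∩
      Ring.jacobson (DoubleCoverLine K m)) = Ideal.span {v} := by
  obtain rfl | rfl := Nat.le_one_iff_eq_zero_or_eq_one.1 hm
  · exact ⟨_, algebraMap_X_mem_nonZeroDivisors, span_inter_jacobson_eq_span_X hS (.inl rfl)⟩
  · obtain hS' | rfl := hS'
    · exact ⟨_, algebraMap_X_mem_nonZeroDivisors, span_inter_jacobson_eq_span_X hS (.inr hS')⟩
    · refine ⟨_, omega_X_mem_nonZeroDivisors, ?_⟩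
      rw [Algebra.coe_top, Set.univ_inter, Ideal.span_eq, jacobson_doubleCoverLine_one_eq_span]

end Multipliers

section NormalizationOfPlanarUnion

open PowerSeries

variable {K : Type*} [Field K]

/-- The rings that the normalization algorithm produces from `planarUnion K m l`. -/
def planarUnionChain (K : Type*) [Field K] (m l : ℕ) : ℕ → Subalgebra K (DoubleCoverLine K m)
  | 0 => planarUnion K m l
  | 1 => spatialUnion K m l
  | i + 2 => disjointUnion K m (l - i)

variable {m l : ℕ}

theorem planarUnion_le_planarUnionChain (i : ℕ) :
    planarUnion K m l ≤ planarUnionChain K m l i := by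
  have hspatial := planarUnion_le_spatialUnion K m l
  match i with
  | 0 => exact le_rfl
  | 1 => exact hspatial
  | i + 2 =>
    exact hspatial.trans <| (spatialUnion_le_disjointUnion K m l).trans <|
      disjointUnion_antitone (show l - i ≤ l + 1 by omega)

theorem planarUnionChain_le_disjointUnion_one_or_eq_top (i : ℕ) :
    planarUnionChain K m l i ≤ disjointUnion K m 1 ∨ planarUnionChain K m l i = ⊤ := by
  have hspatial : spatialUnion K m l ≤ disjointUnion K m 1 :=
    (spatialUnion_le_disjointUnion K m l).trans
      (disjointUnion_antitone (Nat.le_add_left 1 l))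
  match i with
  | 0 => exact .inl ((planarUnion_le_spatialUnion K m l).trans hspatial)
  | 1 => exact .inl hspatial
  | i + 2 =>
    obtain hl | hl := (l - i).eq_zero_or_pos
    · exact .inr (by rw [planarUnionChain, hl, disjointUnion_zero])
    · exact .inl (disjointUnion_antitone hl)

theorem planarUnionChain_stable :
    planarUnionChain K m l (l + 2) = planarUnionChain K m l (l + 2 + 1) := by
  simp only [planarUnionChain, Nat.sub_self, Nat.sub_eq_zero_of_le (Nat.le_succ l)]

theorem planarUnionChain_ne_succ {i : ℕ} (hi : i < l + 2) :
    planarUnionChain K m l i ≠ planarUnionChain K m l (i + 1) := by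
  match i with
  | 0 => exact planarUnion_ne_spatialUnion K m l
  | 1 => exact spatialUnion_ne_disjointUnion K m l
  | i + 2 => exact fun h => by have := disjointUnion_injective K m h; omega

theorem multiplier_planarUnionChain [NeZero (2 : K)] (i : ℕ) :
    multiplier (planarUnionChain K m l i) (Ring.jacobson _) = planarUnionChain K m l (i + 1) :=
  match i with
  | 0 => multiplier_planarUnion
  | 1 => multiplier_spatialUnion
  | _ + 2 => multiplier_disjointUnion

theorem algebraMap_X_pow_mul_mem_planarUnion (t : DoubleCoverLine K m) :
    algebraMap K⟦X⟧ (DoubleCoverLine K m) X ^ (l + 2) * t ∈ planarUnion K m l := by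
  rw [← map_pow, ← Algebra.smul_def]
  refine ⟨⟨dvd_mul_of_dvd_left (pow_dvd_pow X (Nat.le_succ _)) _, ?_⟩, ?_⟩
  · simp
  · simp only [Prod.smul_fst, Prod.smul_snd, QuadraticAlgebra.im_smul, smul_eq_mul,
      coeff_X_pow_mul']
    rw [if_neg (by omega), if_neg (by omega)]

theorem algebraMap_X_dvd_sq_of_mem_jacobson [NeZero (2 : K)] {t : DoubleCoverLine K m}
    (ht : t ∈ Ring.jacobson (DoubleCoverLine K m)) :
    algebraMap K⟦X⟧ (DoubleCoverLine K m) X ∣ t ^ 2 := by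
  obtain ⟨hre, him, hline⟩ := mem_jacobson_doubleCoverLine.1 ht
  rw [algebraMap_X_dvd_iff]
  simp only [sq, Prod.fst_mul, Prod.snd_mul, QuadraticAlgebra.re_mul, QuadraticAlgebra.im_mul,
    zero_mul, add_zero]
  exact ⟨dvd_add (dvd_mul_of_dvd_left hre _) (dvd_mul_of_dvd_left him _),
    dvd_add (dvd_mul_of_dvd_left hre _) (dvd_mul_of_dvd_right hre _),
    dvd_mul_of_dvd_left hline _⟩

variable {A : Type*} [CommRing A] [Algebra A (DoubleCoverLine K m)]
  (hA : (algebraMap A (DoubleCoverLine K m)).range = (planarUnion K m l).toSubring)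

include hA

theorem algebraMap_X_pow_mem_conductorIdeal :
    algebraMap K⟦X⟧ (DoubleCoverLine K m) X ^ (l + 2) ∈ conductorIdeal A (DoubleCoverLine K m) :=
  mem_conductorIdeal.2 fun t => by rw [hA]; exact algebraMap_X_pow_mul_mem_planarUnion t

variable [NeZero (2 : K)]

theorem jacobson_le_radical_conductorIdeal : Ring.jacobson (DoubleCoverLine K m) ≤
    (conductorIdeal A (DoubleCoverLine K m)).radical := by
  refine fun t ht => ⟨2 * (l + 2), ?_⟩
  rw [pow_mul]
  exact Ideal.mem_of_dvd _ (pow_dvd_pow_of_dvd (algebraMap_X_dvd_sq_of_mem_jacobson ht) _)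
    (algebraMap_X_pow_mem_conductorIdeal hA)

variable [Algebra K A] [IsScalarTower K A (DoubleCoverLine K m)]

theorem isIntegral_mk_algebraMap (f g : K⟦X⟧) :
    IsIntegral A ((algebraMap K⟦X⟧ _ f, g) : DoubleCoverLine K m) := by
  have isIntegral_smul (c : K) {e : DoubleCoverLine K m} (he : e * e = e) :
      IsIntegral A (c • e) := by
    rw [← algebraMap_smul A c]
    exact .smul _ ⟨.X ^ 2 - .X, by monicity!, by simp [sq, he]⟩
  let t : DoubleCoverLine K m :=
    (algebraMap K⟦X⟧ _ (f - C (constantCoeff f)), g - C (constantCoeff g))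
  have ht : t ∈ Ring.jacobson (DoubleCoverLine K m) := by
    simp [mem_jacobson_doubleCoverLine, t, X_dvd_iff]
  have heq : ((algebraMap K⟦X⟧ _ f, g) : DoubleCoverLine K m) =
      constantCoeff f • (1, 0) + constantCoeff g • (0, 1) + t := by
    refine Prod.ext (QuadraticAlgebra.ext ?_ ?_) ?_ <;>
      simp [t, smul_eq_C_mul, QuadraticAlgebra.re_one, QuadraticAlgebra.im_one]
  rw [heq]
  exact .add (.add (isIntegral_smul _ (by simp)) (isIntegral_smul _ (by simp)))
    (isIntegral_of_mem_radical_conductorIdeal (jacobson_le_radical_conductorIdeal hA ht))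

theorem isIntegral_doubleCoverLine : Algebra.IsIntegral A (DoubleCoverLine K m) := by
  refine ⟨fun ⟨z, g⟩ => ?_⟩
  have homega : IsIntegral A ((QuadraticAlgebra.omega, 0) : DoubleCoverLine K m) := by
    refine .of_pow (n := 2) two_pos ?_
    have hsq : ((QuadraticAlgebra.omega, 0) : DoubleCoverLine K m) ^ 2 =
        (algebraMap K⟦X⟧ _ (X ^ m), 0) := by
      rw [sq, Prod.mk_mul_mk, zero_mul, QuadraticAlgebra.omega_mul_omega_eq_mk,
        QuadraticAlgebra.algebraMap_eq]
    exact hsq ▸ isIntegral_mk_algebraMap hA (X ^ m) 0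
  have heq : (z, g) = (algebraMap K⟦X⟧ _ z.re, g) +
      (QuadraticAlgebra.omega, 0) * (algebraMap K⟦X⟧ _ z.im, 0) := by
    ext <;> simp
  rw [heq]
  exact .add (isIntegral_mk_algebraMap hA _ _) (.mul homega (isIntegral_mk_algebraMap hA _ _))

end NormalizationOfPlanarUnion

section ScalarExtension

variable {K A T : Type*} [CommRing K] [CommRing A] [CommRing T] [Algebra K T] [Algebra A T]

/-- A subalgebra that contains the image of `A`, regarded as an `A`-subalgebra. -/
def overBase (S : Subalgebra K T) (hS : (algebraMap A T).range ≤ S.toSubring) :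
    Subalgebra A T where
  __ := S
  algebraMap_mem' a := hS ⟨a, rfl⟩

theorem overBase_injective {S S' : Subalgebra K T} {hS : (algebraMap A T).range ≤ S.toSubring}
    {hS' : (algebraMap A T).range ≤ S'.toSubring} (h : overBase S hS = overBase S' hS') :
    S = S' :=
  SetLike.ext fun x => SetLike.ext_iff.1 h x

/-- Changing the base ring of a subalgebra does not change the ring. -/
def overBaseEquiv [Algebra K A] [IsScalarTower K A T] (S : Subalgebra K T)
    (hS : (algebraMap A T).range ≤ S.toSubring) : overBase S hS ≃ₐ[K] S where
  __ := RingEquiv.refl S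
  commutes' _ := rfl

end ScalarExtension

section TypeD

open PowerSeries

variable {K : Type*} [Field K] {m l : ℕ}
variable {A : Type*} [CommRing A]

section

variable [Algebra A (DoubleCoverLine K m)]
  (hA : (algebraMap A (DoubleCoverLine K m)).range = (planarUnion K m l).toSubring)

/-- The chain `planarUnionChain K m l` as a chain of algebras over a ring `A` with image
`planarUnion K m l`. -/
noncomputable def overBaseChain (i : ℕ) : Subalgebra A (DoubleCoverLine K m) :=
  overBase (planarUnionChain K m l i) (hA.trans_le (planarUnion_le_planarUnionChain i))

theorem overBaseChain_zero : overBaseChain hA 0 = ⊥ :=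
  SetLike.ext fun x => (SetLike.ext_iff.1 hA x).symm

theorem overBaseChain_stable : overBaseChain hA (l + 2) = overBaseChain hA (l + 2 + 1) :=
  SetLike.ext fun x => SetLike.ext_iff.1 planarUnionChain_stable x

variable [NeZero (2 : K)]

theorem multiplier_overBaseChain (i : ℕ) :
    multiplier (overBaseChain hA i) (Ring.jacobson _) = overBaseChain hA (i + 1) :=
  SetLike.ext fun x => SetLike.ext_iff.1 (multiplier_planarUnionChain i) x

variable [Algebra K A] [IsScalarTower K A (DoubleCoverLine K m)]

theorem primeRing_map_overBaseChain (hm : m ≤ 1)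
    {ι : DoubleCoverLine K m →ₐ[A] FractionRing A} (hι : Function.Injective ι)
    (hunit : ∀ v ∈ (DoubleCoverLine K m)⁰, IsUnit (ι v)) (i : ℕ) :
    primeRing ((overBaseChain hA i).map ι) = (overBaseChain hA (i + 1)).map ι := by
  have := isIntegral_doubleCoverLine hA
  obtain ⟨v, hv, hspan⟩ := exists_span_inter_jacobson_eq hm
    (planarUnion_le_planarUnionChain (K := K) (l := l) i)
    (planarUnionChain_le_disjointUnion_one_or_eq_top i)
  have hspan' : Ideal.span ((overBaseChain hA i : Set (DoubleCoverLine K m)) ∩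
      Ring.jacobson (DoubleCoverLine K m)) = Ideal.span {v} := hspan
  rw [primeRing_map_eq_map_multiplier hι _ (hunit v hv) hspan', multiplier_overBaseChain]

end

variable [NeZero (2 : K)] [Algebra K A]

theorem normalization_of_algEquiv_planarUnion (hm : m ≤ 1) (e : A ≃ₐ[K] planarUnion K m l) :
    Nonempty ((primeRing ⊥ : Subalgebra A (FractionRing A)) ≃ₐ[K] spatialUnion K m l) ∧
    Nonempty ((primeRing (primeRing ⊥) : Subalgebra A (FractionRing A)) ≃ₐ[K]
      disjointUnion K m l) ∧
    numNormSteps A = l + 2 := by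
  let φ : A →ₐ[K] DoubleCoverLine K m := (planarUnion K m l).val.comp e
  algebraize [φ.toRingHom]
  have hA : (algebraMap A (DoubleCoverLine K m)).range = (planarUnion K m l).toSubring := by
    ext x
    exact ⟨fun ⟨a, ha⟩ => ha ▸ (e a).2, fun hx => ⟨e.symm ⟨x, hx⟩,
      congrArg Subtype.val (e.apply_symm_apply ⟨x, hx⟩)⟩⟩
  have : IsScalarTower K A (DoubleCoverLine K m) := .of_algHom φ
  have : FaithfulSMul A (DoubleCoverLine K m) := (faithfulSMul_iff_algebraMap_injective _ _).2
    (Subtype.val_injective.comp e.injective)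
  have := isIntegral_doubleCoverLine hA
  obtain ⟨ι, hι, hunit⟩ := exists_algHom_fractionRing (algebraMap_X_pow_mem_conductorIdeal hA)
    (pow_mem algebraMap_X_mem_nonZeroDivisors (l + 2))
  have hstep := primeRing_map_overBaseChain hA hm hι hunit
  have hbot : (overBaseChain hA 0).map ι = ⊥ := by rw [overBaseChain_zero, Algebra.map_bot]
  let equivChain (i : ℕ) : (overBaseChain hA i).map ι ≃ₐ[K] planarUnionChain K m l i :=
    (((overBaseChain hA i).equivMapOfInjective ι hι).symm.restrictScalars K).trans
      (overBaseEquiv _ _)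
  refine ⟨?_, ?_, ?_⟩
  · rw [← hbot, hstep]
    exact ⟨equivChain 1⟩
  · rw [← hbot, hstep, hstep]
    exact ⟨equivChain 2⟩
  · exact numNormSteps_eq hι (jacobson_le_radical_conductorIdeal hA)
      (overBaseChain_zero hA) hstep (overBaseChain_stable hA)
      fun i hi h => planarUnionChain_ne_succ hi (overBase_injective h)

end TypeD

section QuadraticResidue

open QuadraticAlgebra

variable {R : Type*} [CommRing R]

theorem isDistinguishedAt_X_sq_sub_C [Nontrivial R] {I : Ideal R} {a : R} (ha : a ∈ I) :
    (Polynomial.X ^ 2 - Polynomial.C a).IsDistinguishedAt I := by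
  refine ⟨⟨fun {n} hn => ?_⟩, Polynomial.monic_X_pow_sub_C _ two_ne_zero⟩
  rw [Polynomial.natDegree_X_pow_sub_C] at hn
  rw [Polynomial.coeff_sub, Polynomial.coeff_X_pow, if_neg hn.ne, zero_sub, neg_mem_iff,
    Polynomial.coeff_C]
  split_ifs
  exacts [ha, zero_mem _]

/-- `R[Y] / ⟨Y² - a⟩` as a quadratic algebra. -/
noncomputable def adjoinRootSqSubEquiv (a : R) :
    AdjoinRoot (Polynomial.X ^ 2 - Polynomial.C a) ≃ₐ[R] QuadraticAlgebra R a 0 :=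
  have hroot : AdjoinRoot.root (Polynomial.X ^ 2 - Polynomial.C a) * AdjoinRoot.root _ =
      a • 1 + (0 : R) • AdjoinRoot.root _ := by
    have h := AdjoinRoot.eval₂_root (Polynomial.X ^ 2 - Polynomial.C a)
    rw [Polynomial.eval₂_sub, Polynomial.eval₂_pow, Polynomial.eval₂_X, Polynomial.eval₂_C] at h
    rw [← sq, sub_eq_zero.1 h, zero_smul, add_zero, Algebra.smul_def, mul_one]
    rfl
  have homega : Polynomial.eval₂
      ((Algebra.ofId R (QuadraticAlgebra R a 0) : R →ₐ[R] _) : R →+* QuadraticAlgebra R a 0)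
      (omega : QuadraticAlgebra R a 0) (Polynomial.X ^ 2 - Polynomial.C a) = 0 := by
    rw [Polynomial.eval₂_sub, Polynomial.eval₂_pow, Polynomial.eval₂_X, Polynomial.eval₂_C, sq,
      omega_mul_omega_eq_mk]
    exact sub_self _
  .ofAlgHom (AdjoinRoot.liftAlgHom _ (Algebra.ofId _ _) omega homega)
    (QuadraticAlgebra.lift ⟨_, hroot⟩)
    (algHom_ext (by
      simp [QuadraticAlgebra.lift, AdjoinRoot.liftAlgHom_root _ (Algebra.ofId R _) _ homega]))
    (AdjoinRoot.algHom_ext (by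
      simp [QuadraticAlgebra.lift, AdjoinRoot.liftAlgHom_root _ (Algebra.ofId R _) _ homega]))

theorem adjoinRootSqSubEquiv_root (a : R) :
    adjoinRootSqSubEquiv a (AdjoinRoot.root _) = omega := by
  rw [adjoinRootSqSubEquiv, AlgEquiv.ofAlgHom_apply, AdjoinRoot.liftAlgHom_root]

variable [Nontrivial R] (K : Type*) [CommRing K] [Algebra K R] {I : Ideal R}
  [IsAdicComplete I R] {a : R} (ha : a ∈ I)

/-- `R⟦Y⟧ / ⟨Y² - a⟩` as a quadratic algebra, by Weierstrass division. -/
noncomputable def quotientSqSubEquiv :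
    (PowerSeries R ⧸ Ideal.span {((Polynomial.X ^ 2 - Polynomial.C a : Polynomial R) :
      PowerSeries R)}) ≃ₐ[R] QuadraticAlgebra R a 0 :=
  (isDistinguishedAt_X_sq_sub_C ha).algEquivQuotient.symm.trans (adjoinRootSqSubEquiv a)

/-- The residue of a power series in `Y` modulo `Y² - a`. -/
noncomputable def quadraticResidue : PowerSeries R →ₐ[K] QuadraticAlgebra R a 0 :=
  ((quotientSqSubEquiv ha).toAlgHom.comp (Ideal.Quotient.mkₐ R _)).restrictScalars K

theorem quadraticResidue_coe (p : Polynomial R) :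
    quadraticResidue K ha p = adjoinRootSqSubEquiv a (AdjoinRoot.mk _ p) :=
  congrArg (adjoinRootSqSubEquiv a)
    ((isDistinguishedAt_X_sq_sub_C ha).algEquivQuotient.symm_apply_apply (AdjoinRoot.mk _ p))

theorem quadraticResidue_X : quadraticResidue K ha PowerSeries.X = omega := by
  rw [← Polynomial.coe_X, quadraticResidue_coe, AdjoinRoot.mk_X, adjoinRootSqSubEquiv_root]

theorem quadraticResidue_C (x : R) : quadraticResidue K ha (PowerSeries.C x) = ⟨x, 0⟩ := by
  rw [← Polynomial.coe_C, quadraticResidue_coe, AdjoinRoot.mk_C]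
  exact (adjoinRootSqSubEquiv a).commutes x

theorem quadraticResidue_C_add_C_mul_X (x y : R) :
    quadraticResidue K ha (PowerSeries.C x + PowerSeries.C y * PowerSeries.X) = ⟨x, y⟩ := by
  rw [map_add, map_mul, quadraticResidue_C, quadraticResidue_C, quadraticResidue_X]
  ext <;> simp

theorem quadraticResidue_surjective : Function.Surjective (quadraticResidue K ha) :=
  fun z => ⟨_, quadraticResidue_C_add_C_mul_X K ha z.re z.im⟩

theorem ker_quadraticResidue : RingHom.ker (quadraticResidue K ha) =
    Ideal.span {PowerSeries.X ^ 2 - PowerSeries.C a} := by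
  rw [← Polynomial.coe_X, ← Polynomial.coe_C, ← Polynomial.coe_pow, ← Polynomial.coe_sub]
  ext f
  change quotientSqSubEquiv ha (Ideal.Quotient.mk _ f) = 0 ↔ _
  rw [EmbeddingLike.map_eq_zero_iff, Ideal.Quotient.eq_zero_iff_mem]

end QuadraticResidue

section IteratedPowerSeries

open PowerSeries

/-- The isomorphism of power series rings induced by an isomorphism of the coefficients. -/
noncomputable def mapEquiv {K A B : Type*} [CommSemiring K] [Semiring A] [Semiring B] [Algebra K A]
    [Algebra K B] (e : A ≃ₐ[K] B) : A⟦X⟧ ≃ₐ[K] B⟦X⟧ :=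
  .ofAlgHom (mapAlgHom e.toAlgHom) (mapAlgHom e.symm.toAlgHom)
    (by ext f n; simp [mapAlgHom_apply]) (by ext f n; simp [mapAlgHom_apply])

section MapEquiv

variable {K A B : Type*} [CommSemiring K] [CommSemiring A] [CommSemiring B] [Algebra K A]
  [Algebra K B] (e : A ≃ₐ[K] B)

theorem mapEquiv_X : mapEquiv e X = X := by
  rw [mapEquiv, AlgEquiv.ofAlgHom_apply, mapAlgHom_apply, map_X]

theorem mapEquiv_C (a : A) : mapEquiv e (C a) = C (e a) := by
  rw [mapEquiv, AlgEquiv.ofAlgHom_apply, mapAlgHom_apply, map_C]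
  rfl

end MapEquiv

variable (K : Type*) [CommRing K]

/-- The identification of `K⟦X, Y⟧` with `K⟦Y⟧⟦X⟧`. -/
noncomputable def planeEquiv : MvPowerSeries (Fin 2) K ≃ₐ[K] K⟦X⟧⟦X⟧ :=
  (MvPowerSeries.finSuccEquiv K 1).trans
    (mapEquiv (MvPowerSeries.renameEquiv K (Equiv.ofUnique (Fin 1) Unit)))

theorem planeEquiv_X_zero : planeEquiv K (MvPowerSeries.X 0) = X := by
  rw [planeEquiv, AlgEquiv.trans_apply, MvPowerSeries.finSuccEquiv_X_zero, mapEquiv_X]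

theorem planeEquiv_X_one : planeEquiv K (MvPowerSeries.X 1) = C X := by
  rw [planeEquiv, AlgEquiv.trans_apply, ← Fin.succ_zero_eq_one,
    MvPowerSeries.finSuccEquiv_X_succ, mapEquiv_C]
  exact congrArg C (MvPowerSeries.rename_X _ _)

/-- The identification of `K⟦X, Y⟧` with `K⟦X⟧⟦Y⟧`. -/
noncomputable def planeEquivSwap : MvPowerSeries (Fin 2) K ≃ₐ[K] K⟦X⟧⟦X⟧ :=
  (MvPowerSeries.renameEquiv K (Equiv.swap 0 1)).trans (planeEquiv K)

theorem planeEquivSwap_X_zero : planeEquivSwap K (MvPowerSeries.X 0) = C X := by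
  rw [← planeEquiv_X_one]
  exact congrArg (planeEquiv K) (MvPowerSeries.rename_X _ _)

theorem planeEquivSwap_X_one : planeEquivSwap K (MvPowerSeries.X 1) = X := by
  rw [← planeEquiv_X_zero]
  exact congrArg (planeEquiv K) (MvPowerSeries.rename_X _ _)

/-- The identification of `K⟦X, Y, Z⟧` with `K⟦X⟧⟦Y⟧⟦Z⟧`. -/
noncomputable def spaceEquiv : MvPowerSeries (Fin 3) K ≃ₐ[K] K⟦X⟧⟦X⟧⟦X⟧ :=
  (MvPowerSeries.renameEquiv K Fin.revPerm).trans
    ((MvPowerSeries.finSuccEquiv K 2).trans (mapEquiv (planeEquiv K)))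

theorem spaceEquiv_X_zero : spaceEquiv K (MvPowerSeries.X 0) = C (C X) := by
  have hrev : MvPowerSeries.renameEquiv K Fin.revPerm (MvPowerSeries.X (0 : Fin 3)) =
      MvPowerSeries.X (Fin.succ 1 : Fin 3) := MvPowerSeries.rename_X _ _
  rw [spaceEquiv, AlgEquiv.trans_apply, AlgEquiv.trans_apply, hrev,
    MvPowerSeries.finSuccEquiv_X_succ, mapEquiv_C, planeEquiv_X_one]

theorem spaceEquiv_X_one : spaceEquiv K (MvPowerSeries.X 1) = C X := by
  have hrev : MvPowerSeries.renameEquiv K Fin.revPerm (MvPowerSeries.X (1 : Fin 3)) =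
      MvPowerSeries.X (Fin.succ 0 : Fin 3) := MvPowerSeries.rename_X _ _
  rw [spaceEquiv, AlgEquiv.trans_apply, AlgEquiv.trans_apply, hrev,
    MvPowerSeries.finSuccEquiv_X_succ, mapEquiv_C, planeEquiv_X_zero]

theorem spaceEquiv_X_two : spaceEquiv K (MvPowerSeries.X 2) = X := by
  have hrev : MvPowerSeries.renameEquiv K Fin.revPerm (MvPowerSeries.X (2 : Fin 3)) =
      MvPowerSeries.X (0 : Fin 3) := MvPowerSeries.rename_X _ _
  rw [spaceEquiv, AlgEquiv.trans_apply, AlgEquiv.trans_apply, hrev,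
    MvPowerSeries.finSuccEquiv_X_zero, mapEquiv_X]

end IteratedPowerSeries

section AttachedLine

open PowerSeries

theorem ker_map_powerSeries {R S : Type*} [CommRing R] [CommRing S] {ε : R →+* S}
    (hε : (RingHom.ker ε).FG) : RingHom.ker (map ε) = (RingHom.ker ε).map C := by
  refine le_antisymm (fun f hf => ?_) (Ideal.map_le_iff_le_comap.2 fun r hr => ?_)
  · obtain ⟨s, hs⟩ := hε
    have hcoeff (n : ℕ) : ∃ c : R → R, ∑ a ∈ s, c a * a = coeff n f := by
      have hmem : coeff n f ∈ RingHom.ker ε := by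
        rw [RingHom.mem_ker, ← coeff_map, RingHom.mem_ker.1 hf, map_zero]
      rw [← hs] at hmem
      obtain ⟨c, -, hc⟩ := Submodule.mem_span_finset.1 hmem
      exact ⟨c, hc⟩
    choose c hc using hcoeff
    have hf' : f = ∑ a ∈ s, mk (c · a) * C a := by
      ext n
      simp only [map_sum, coeff_mul_C, coeff_mk, hc]
    rw [hf']
    exact sum_mem fun a ha => Ideal.mul_mem_left _ _
      (Ideal.mem_map_of_mem _ (hs ▸ Ideal.subset_span ha))
  · rw [Ideal.mem_comap, RingHom.mem_ker, map_C, RingHom.mem_ker.1 hr, map_zero]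

theorem constantCoeff_map {R S : Type*} [Semiring R] [Semiring S] (f : R →+* S) (g : R⟦X⟧) :
    constantCoeff (map f g) = f (constantCoeff g) :=
  MvPowerSeries.constantCoeff_map f g

/-- `constantCoeff` as an algebra homomorphism. -/
noncomputable def constantCoeffHom (K R : Type*) [CommSemiring K] [CommSemiring R] [Algebra K R] :
    R⟦X⟧ →ₐ[K] R where
  __ := constantCoeff (R := R)
  commutes' c := by
    change constantCoeff (algebraMap K R⟦X⟧ c) = _
    rw [PowerSeries.algebraMap_apply, constantCoeff_C]

variable {K R B : Type*} [CommRing K] [CommRing R] [CommRing B] [Algebra K R] [Algebra K B]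

theorem constantCoeffHom_apply (f : R⟦X⟧) : constantCoeffHom K R f = constantCoeff f :=
  rfl

theorem ker_mapAlgHom {p : R →ₐ[K] K} (hp : (RingHom.ker p).FG) :
    RingHom.ker (mapAlgHom p) = (RingHom.ker p).map C :=
  ker_map_powerSeries (ε := p.toRingHom) hp

theorem mapAlgHom_map_algebraMap (p : R →ₐ[K] K) (g : K⟦X⟧) :
    mapAlgHom p (map (algebraMap K R) g) = g := by
  ext n
  rw [mapAlgHom_apply, coeff_map, coeff_map]
  exact p.commutes _

variable {φ : R →ₐ[K] B}

theorem ker_inf_ker_mapAlgHom {p : R →ₐ[K] K} (hφ : RingHom.ker φ ≤ RingHom.ker p)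
    (hp : (RingHom.ker p).FG) :
    RingHom.ker (φ.comp (constantCoeffHom K R)) ⊓ RingHom.ker (mapAlgHom p) =
      (RingHom.ker φ).map C ⊔ Ideal.span {X} * (RingHom.ker p).map C := by
  rw [ker_mapAlgHom hp]
  refine le_antisymm (fun f hf => ?_) (sup_le (le_inf ?_ (Ideal.map_mono hφ)) (le_inf ?_ ?_))
  · have hconst : C (constantCoeff f) ∈ (RingHom.ker φ).map C := Ideal.mem_map_of_mem _ hf.1
    have hshift : X * mk (fun n => coeff (n + 1) f) ∈ (RingHom.ker p).map C := by
      rw [← sub_const_eq_X_mul_shift]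
      exact sub_mem hf.2 (Ideal.map_mono hφ hconst)
    rw [eq_X_mul_shift_add_const f, add_comm]
    refine Submodule.add_mem_sup hconst (Ideal.mul_mem_mul (Ideal.mem_span_singleton_self X) ?_)
    rw [← ker_mapAlgHom hp, RingHom.mem_ker] at hshift ⊢
    rw [map_mul, mapAlgHom_apply, map_X] at hshift
    exact X_mul_cancel (hshift.trans (mul_zero X).symm)
  · refine Ideal.map_le_iff_le_comap.2 fun r hr => ?_
    rwa [Ideal.mem_comap, RingHom.mem_ker, AlgHom.comp_apply, constantCoeffHom_apply,
      constantCoeff_C]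
  · refine Ideal.mul_le_left.trans ((Ideal.span_singleton_le_iff_mem _).2 ?_)
    rw [RingHom.mem_ker, AlgHom.comp_apply, constantCoeffHom_apply, constantCoeff_X, map_zero]
  · exact Ideal.mul_le_right

theorem ker_sup_ker_mapAlgHom {p : R →ₐ[K] K} (hφ : RingHom.ker φ ≤ RingHom.ker p) :
    RingHom.ker (φ.comp (constantCoeffHom K R)) ⊔ RingHom.ker (mapAlgHom p) =
      RingHom.ker (p.comp (constantCoeffHom K R)) := by
  refine le_antisymm (sup_le (fun f hf => hφ hf) fun f hf => ?_) fun f hf => ?_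
  · have h := congrArg constantCoeff (RingHom.mem_ker.1 hf)
    rwa [mapAlgHom_apply, map_zero, constantCoeff_map] at h
  · rw [eq_X_mul_shift_add_const f]
    refine Submodule.add_mem_sup ?_ ?_
    · rw [RingHom.mem_ker, AlgHom.comp_apply, constantCoeffHom_apply, map_mul, constantCoeff_X,
        zero_mul, map_zero]
    · rw [RingHom.mem_ker, mapAlgHom_apply, map_C]
      exact (congrArg C hf).trans (map_zero C)

theorem mem_range_prod_mapAlgHom (hφ : Function.Surjective φ) {ε : B →ₐ[K] K} {x : B × K⟦X⟧} :
    x ∈ ((φ.comp (constantCoeffHom K R)).prod (mapAlgHom (ε.comp φ))).range ↔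
      ε x.1 = constantCoeff x.2 := by
  constructor
  · rintro ⟨f, rfl⟩
    exact (constantCoeff_map (ε.comp φ).toRingHom f).symm
  · obtain ⟨b, g⟩ := x
    intro h
    obtain ⟨r, rfl⟩ := hφ b
    have h' : (ε.comp φ) r = constantCoeff g := h
    refine ⟨C r + map (algebraMap K R) (g - C (constantCoeff g)), Prod.ext ?_ ?_⟩
    · change φ (constantCoeff _) = φ r
      rw [map_add, constantCoeff_C, constantCoeff_map, map_sub constantCoeff, constantCoeff_C,
        sub_self, map_zero, add_zero]
    · change mapAlgHom (ε.comp φ) _ = g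
      rw [map_add, mapAlgHom_map_algebraMap, mapAlgHom_apply, map_C, ← h']
      exact add_sub_cancel _ _

end AttachedLine

section Presentations

open PowerSeries

/-- The ring `K⟦X, Y⟧ / ⟨X² - Y^(k+1)⟩` of a singularity of type `A_k`. -/
abbrev TypeARing (K : Type*) [CommRing K] (k : ℕ) : Type _ :=
  MvPowerSeries (Fin 2) K ⧸ Ideal.span
    {(MvPowerSeries.X 0 ^ 2 - MvPowerSeries.X 1 ^ (k + 1) : MvPowerSeries (Fin 2) K)}

/-- The ring `K⟦X, Y⟧ / ⟨X(Y² - X^(n-2))⟩` of a singularity of type `D_n`, for `n ≥ 4`. -/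
abbrev TypeDRing (K : Type*) [CommRing K] (n : ℕ) : Type _ :=
  MvPowerSeries (Fin 2) K ⧸ Ideal.span
    {(MvPowerSeries.X 0 * (MvPowerSeries.X 1 ^ 2 - MvPowerSeries.X 0 ^ (n - 2)) :
      MvPowerSeries (Fin 2) K)}

/-- The ideal of `K⟦X, Y, Z⟧` presenting the space curve singularity `A_k ∨ L`. -/
noncomputable abbrev idealAVeeL (K : Type*) [CommRing K] (k : ℕ) :
    Ideal (MvPowerSeries (Fin 3) K) :=
  maximalMinors !![.X 2, .X 1, .X 0 ^ k; 0, .X 0, .X 1]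

theorem maximalMinors_eq_span {R : Type*} [CommRing R] (x y z w : R) :
    maximalMinors !![z, y, w; 0, x, y] = Ideal.span {z * x, z * y, y ^ 2 - w * x} := by
  refine le_antisymm (Ideal.span_le.2 ?_) (Ideal.span_le.2 ?_)
  · rintro _ ⟨f, rfl⟩
    change (!![z, y, w; 0, x, y].submatrix id f).det ∈ Ideal.span {z * x, z * y, y ^ 2 - w * x}
    have hzx : z * x ∈ Ideal.span {z * x, z * y, y ^ 2 - w * x} := Ideal.subset_span (by simp)
    have hzy : z * y ∈ Ideal.span {z * x, z * y, y ^ 2 - w * x} := Ideal.subset_span (by simp)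
    have hyw : y ^ 2 - w * x ∈ Ideal.span {z * x, z * y, y ^ 2 - w * x} :=
      Ideal.subset_span (by simp)
    generalize Ideal.span {z * x, z * y, y ^ 2 - w * x} = I at hzx hzy hyw ⊢
    have hwy : w * x - y ^ 2 ∈ I := by simpa only [neg_sub] using neg_mem hyw
    rw [Matrix.det_fin_two]
    simp only [Matrix.submatrix_apply, id_eq]
    generalize f 0 = i
    generalize f 1 = j
    rw [sq, mul_comm w] at hyw hwy
    rw [mul_comm] at hzx hzy
    fin_cases i <;> fin_cases j <;> simp [hzx, hzy, hyw, hwy, mul_comm]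
  · have hminor (i j : Fin 3) : (!![z, y, w; 0, x, y].submatrix id ![i, j]).det ∈
        maximalMinors !![z, y, w; 0, x, y] := Ideal.subset_span ⟨![i, j], rfl⟩
    rintro _ (rfl | rfl | rfl)
    · simpa [Matrix.det_fin_two] using hminor 0 1
    · simpa [Matrix.det_fin_two] using hminor 0 2
    · simpa [Matrix.det_fin_two, sq] using hminor 1 2

variable {K : Type*} [Field K]

section Residue

variable (K) (M : ℕ) [NeZero M]

theorem X_pow_mem_span_X : (X : K⟦X⟧) ^ M ∈ Ideal.span {X} :=
  Ideal.mem_span_singleton.2 (dvd_pow_self X (NeZero.ne M))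

/-- The residue of a power series in `X` and `Y` modulo `Y² - X^M`. -/
noncomputable def doubleCoverResidue : K⟦X⟧⟦X⟧ →ₐ[K] DoubleCover K M :=
  quadraticResidue K (X_pow_mem_span_X K M)

theorem doubleCoverResidue_surjective : Function.Surjective (doubleCoverResidue K M) :=
  quadraticResidue_surjective K _

theorem ker_doubleCoverResidue :
    RingHom.ker (doubleCoverResidue K M) = Ideal.span {X ^ 2 - C (X ^ M)} :=
  ker_quadraticResidue K _

theorem exists_eq_C_add_C_mul_X_add (f : K⟦X⟧⟦X⟧) :
    ∃ q, f = C (doubleCoverResidue K M f).re + C (doubleCoverResidue K M f).im * X +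
      (X ^ 2 - C (X ^ M)) * q := by
  set z := doubleCoverResidue K M f with hz
  have hmem : f - (C z.re + C z.im * X) ∈ RingHom.ker (doubleCoverResidue K M) := by
    rw [RingHom.mem_ker, map_sub, ← hz]
    exact sub_eq_zero.2 (quadraticResidue_C_add_C_mul_X K (X_pow_mem_span_X K M) z.re z.im).symm
  rw [ker_doubleCoverResidue, Ideal.mem_span_singleton] at hmem
  obtain ⟨q, hq⟩ := hmem
  exact ⟨q, sub_eq_iff_eq_add'.1 hq⟩

/-- The isomorphism of the ring of a singularity of type `A` with a double cover. -/
noncomputable def typeARingEquiv : TypeARing K (M - 1) ≃ₐ[K] DoubleCover K M :=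
  (Ideal.quotientEquivAlg _ (RingHom.ker (doubleCoverResidue K M)) (planeEquiv K) (by
    rw [ker_doubleCoverResidue, Ideal.map_span, Set.image_singleton,
      Nat.sub_add_cancel (NeZero.one_le : 1 ≤ M)]
    simp only [RingHom.coe_coe, map_sub, map_pow, planeEquiv_X_zero, planeEquiv_X_one])).trans
    (Ideal.quotientKerAlgEquivOfSurjective (doubleCoverResidue_surjective K M))

end Residue

end Presentations

section ScaledDoubleCover

open PowerSeries

/-- The isomorphism of a quotient with a subalgebra `T`, given by a homomorphism with values in a
ring that contains `T`. -/
noncomputable def quotientEquivOfRangeEqComap {K S R B C : Type*} [CommRing K] [CommRing S]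
    [CommRing R] [CommRing B] [CommRing C] [Algebra K S] [Algebra K R] [Algebra K B] [Algebra K C]
    {I : Ideal S} {T : Subalgebra K C} (e : S ≃ₐ[K] R) {f : R →ₐ[K] B}
    (hI : RingHom.ker f = I.map (e : S →+* R)) {g : B →ₐ[K] C} (hg : Function.Injective g)
    (hf : f.range = T.comap g) (hT : T ≤ g.range) : (S ⧸ I) ≃ₐ[K] T :=
  (Ideal.quotientEquivAlg I (RingHom.ker f) e hI).trans <|
    (Ideal.quotientKerEquivRange f).trans <|
    (f.range.equivMapOfInjective g hg).trans <|
    Subalgebra.equivOfEq _ _ ((congrArg _ hf).trans (Subalgebra.map_comap_eq_self hT))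

theorem ker_algHom_prod {K R B C : Type*} [CommRing K] [CommRing R] [CommRing B] [CommRing C]
    [Algebra K R] [Algebra K B] [Algebra K C] (f : R →ₐ[K] B) (g : R →ₐ[K] C) :
    RingHom.ker (f.prod g) = RingHom.ker f ⊓ RingHom.ker g :=
  Ideal.ext fun _ => Prod.mk_eq_zero

section Scale

variable (K : Type*) [CommRing K] (m l : ℕ)

/-- The partial normalization of `Y² = X^(2l+m)` given by `Y = X^l ω`. -/
noncomputable def scaleDoubleCover : DoubleCover K (2 * l + m) →ₐ[K] DoubleCover K m where
  toFun z := ⟨z.re, X ^ l * z.im⟩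
  map_one' := QuadraticAlgebra.ext rfl (mul_zero _)
  map_mul' z w := by ext1 <;> simp <;> ring
  map_zero' := QuadraticAlgebra.ext rfl (mul_zero _)
  map_add' z w := QuadraticAlgebra.ext rfl (mul_add _ _ _)
  commutes' c := QuadraticAlgebra.ext rfl (mul_zero _)

/-- `scaleDoubleCover` on the curve, and the identity on the line. -/
noncomputable def scaleDoubleCoverLine : DoubleCoverLine K (2 * l + m) →ₐ[K] DoubleCoverLine K m :=
  (scaleDoubleCover K m l).prodMap (AlgHom.id K K⟦X⟧)

variable {K m l}

theorem scaleDoubleCoverLine_apply (x : DoubleCoverLine K (2 * l + m)) :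
    scaleDoubleCoverLine K m l x = (⟨x.1.re, X ^ l * x.1.im⟩, x.2) :=
  rfl

variable (K m l)

theorem scaleDoubleCoverLine_injective : Function.Injective (scaleDoubleCoverLine K m l) := by
  rintro ⟨z, g⟩ ⟨w, h⟩ heq
  simp only [scaleDoubleCoverLine_apply, Prod.mk.injEq, QuadraticAlgebra.mk.injEq] at heq
  exact Prod.ext (QuadraticAlgebra.ext heq.1.1 (X_pow_mul_cancel heq.1.2)) heq.2

theorem range_scaleDoubleCoverLine : (scaleDoubleCoverLine K m l).range = disjointUnion K m l := by
  ext ⟨⟨a, b⟩, g⟩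
  constructor
  · rintro ⟨x, hx⟩
    rw [← hx]
    exact dvd_mul_right _ _
  · rintro ⟨c, hc⟩
    exact ⟨(⟨a, c⟩, g), Prod.ext (QuadraticAlgebra.ext rfl hc.symm) rfl⟩

/-- `disjointUnion K m l` is the disjoint union of `Y² = X^(2l+m)` and a line. -/
noncomputable def disjointUnionEquiv : disjointUnion K m l ≃ₐ[K] DoubleCoverLine K (2 * l + m) :=
  ((AlgEquiv.ofInjective _ (scaleDoubleCoverLine_injective K m l)).trans
    (Subalgebra.equivOfEq _ _ (range_scaleDoubleCoverLine K m l))).symm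

variable {K m l}

theorem scaleDoubleCoverLine_mem_spatialUnion {x : DoubleCoverLine K (2 * (l + 1) + m)} :
    scaleDoubleCoverLine K m (l + 1) x ∈ spatialUnion K m l ↔
      constantCoeff x.1.re = constantCoeff x.2 :=
  and_iff_right (dvd_mul_right _ _)

theorem scaleDoubleCoverLine_mem_planarUnion {x : DoubleCoverLine K (2 * (l + 1) + m)} :
    scaleDoubleCoverLine K m (l + 1) x ∈ planarUnion K m l ↔
      constantCoeff x.1.re = constantCoeff x.2 ∧ constantCoeff x.1.im = coeff 1 x.2 := by
  rw [mem_planarUnion, scaleDoubleCoverLine_mem_spatialUnion, scaleDoubleCoverLine_apply,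
    coeff_X_pow_mul', if_pos le_rfl, Nat.sub_self, coeff_zero_eq_constantCoeff]

end Scale

end ScaledDoubleCover

section PlanarPresentation

open PowerSeries

variable (K : Type*) [Field K] (M : ℕ) [NeZero M]

/-- The restriction of power series in `X` and `Y` to the curve `Y² = X^M` and the line `X = 0`. -/
noncomputable def planarRestriction : K⟦X⟧⟦X⟧ →ₐ[K] DoubleCoverLine K M :=
  (doubleCoverResidue K M).prod (mapAlgHom (constantCoeffHom K K))

theorem ker_constantCoeffHom : RingHom.ker (constantCoeffHom K K) = Ideal.span {X} := by
  ext f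
  rw [RingHom.mem_ker, constantCoeffHom_apply, ← X_dvd_iff, Ideal.mem_span_singleton]

theorem ker_mapAlgHom_constantCoeffHom :
    RingHom.ker (mapAlgHom (constantCoeffHom K K)) = Ideal.span {C X} := by
  rw [ker_mapAlgHom (IsNoetherian.noetherian _), ker_constantCoeffHom, Ideal.map_span,
    Set.image_singleton]

theorem ker_planarRestriction :
    RingHom.ker (planarRestriction K M) = Ideal.span {C X * (X ^ 2 - C (X ^ M))} := by
  have dvd_of_dvd_C_X_mul (q : K⟦X⟧⟦X⟧) (h : X ^ 2 - C (X ^ M) ∣ C X * q) :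
      X ^ 2 - C (X ^ M) ∣ q := by
    have hX : doubleCoverResidue K M (C X) = ⟨X, 0⟩ := quadraticResidue_C K _ X
    rw [← Ideal.mem_span_singleton, ← ker_doubleCoverResidue, RingHom.mem_ker] at h ⊢
    rw [map_mul, hX, QuadraticAlgebra.ext_iff] at h
    simpa [QuadraticAlgebra.ext_iff, X_ne_zero] using h
  rw [planarRestriction, ker_algHom_prod, ker_doubleCoverResidue, ker_mapAlgHom_constantCoeffHom]
  ext f
  rw [Ideal.mem_inf, Ideal.mem_span_singleton, Ideal.mem_span_singleton, Ideal.mem_span_singleton]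
  constructor
  · rintro ⟨hcurve, q, rfl⟩
    exact mul_dvd_mul_left _ (dvd_of_dvd_C_X_mul q hcurve)
  · exact fun hf => ⟨(dvd_mul_left _ _).trans hf, (dvd_mul_right _ _).trans hf⟩

variable {K M}

theorem mapAlgHom_constantCoeffHom_linear (a b : K⟦X⟧) (q : K⟦X⟧⟦X⟧) :
    mapAlgHom (constantCoeffHom K K) (C a + C b * X + (X ^ 2 - C (X ^ M)) * q) =
      C (constantCoeff a) + C (constantCoeff b) * X +
        X ^ 2 * mapAlgHom (constantCoeffHom K K) q := by
  have hC (c : K⟦X⟧) : mapAlgHom (constantCoeffHom K K) (C c) = C (constantCoeff c) := map_C _ c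
  have hX : mapAlgHom (constantCoeffHom K K) X = X := map_X _
  simp only [map_add, map_sub, map_mul, map_pow, hC, hX, constantCoeff_X,
    zero_pow (NeZero.ne M), map_zero, sub_zero]

theorem mem_range_planarRestriction {x : DoubleCoverLine K M} :
    x ∈ (planarRestriction K M).range ↔
      constantCoeff x.1.re = constantCoeff x.2 ∧ constantCoeff x.1.im = coeff 1 x.2 := by
  constructor
  · rintro ⟨f, rfl⟩
    obtain ⟨q, hq⟩ := exists_eq_C_add_C_mul_X_add K M f
    have hline := congrArg (mapAlgHom (constantCoeffHom K K)) hq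
    rw [mapAlgHom_constantCoeffHom_linear] at hline
    change _ = constantCoeff (mapAlgHom (constantCoeffHom K K) f) ∧
      _ = coeff 1 (mapAlgHom (constantCoeffHom K K) f)
    rw [hline]
    constructor
    · simp [planarRestriction]
    · simp [planarRestriction, coeff_X_pow_mul', coeff_C]
  · obtain ⟨⟨a, b⟩, g⟩ := x
    rintro ⟨hconst, hlin⟩
    dsimp only at hconst hlin
    have hg : X ^ 2 ∣ g - (C (constantCoeff a) + C (constantCoeff b) * X) := by
      rw [X_pow_dvd_iff]
      intro i hi
      interval_cases i
      · simp [hconst]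
      · simp [hlin, coeff_C]
    obtain ⟨q, hq⟩ := hg
    refine ⟨C a + C b * X + (X ^ 2 - C (X ^ M)) * map (algebraMap K K⟦X⟧) q, Prod.ext ?_ ?_⟩
    · have hker : (X ^ 2 - C (X ^ M)) * map (algebraMap K K⟦X⟧) q ∈
          RingHom.ker (doubleCoverResidue K M) := by
        rw [ker_doubleCoverResidue]
        exact Ideal.mul_mem_right _ _ (Ideal.mem_span_singleton_self _)
      change doubleCoverResidue K M _ = _
      rw [map_add, RingHom.mem_ker.1 hker, add_zero]
      exact quadraticResidue_C_add_C_mul_X K _ a b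
    · change mapAlgHom (constantCoeffHom K K) _ = g
      rw [mapAlgHom_constantCoeffHom_linear, mapAlgHom_map_algebraMap, ← hq, add_sub_cancel]

variable (K) (m l : ℕ)

/-- The isomorphism of the ring of a singularity of type `D` with `planarUnion`. -/
noncomputable def typeDRingEquiv :
    TypeDRing K (2 * (l + 1) + m + 2) ≃ₐ[K] planarUnion K m l :=
  haveI : NeZero (2 * (l + 1) + m) := ⟨by omega⟩
  quotientEquivOfRangeEqComap (planeEquivSwap K) (f := planarRestriction K (2 * (l + 1) + m))
    (by
      rw [ker_planarRestriction, Ideal.map_span, Set.image_singleton]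
      simp only [RingHom.coe_coe, map_mul, map_sub, map_pow, planeEquivSwap_X_zero,
        planeEquivSwap_X_one, Nat.add_sub_cancel])
    (scaleDoubleCoverLine_injective K m (l + 1))
    (by ext x; exact mem_range_planarRestriction.trans scaleDoubleCoverLine_mem_planarUnion.symm)
    (range_scaleDoubleCoverLine K m (l + 1) ▸
      (planarUnion_le_spatialUnion K m l).trans (spatialUnion_le_disjointUnion K m l))

end PlanarPresentation

section SpatialPresentation

open PowerSeries

variable (K : Type*) [Field K]

theorem ker_comp_constantCoeffHom {R S : Type*} [CommRing R] [Algebra K R] [CommRing S]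
    [Algebra K S] (f : R →ₐ[K] S) : RingHom.ker (f.comp (constantCoeffHom K R)) =
      Ideal.span {X} ⊔ (RingHom.ker f).map C := by
  refine le_antisymm (fun g hg => ?_) (sup_le ?_ (Ideal.map_le_iff_le_comap.2 fun r hr => ?_))
  · rw [eq_X_mul_shift_add_const g]
    exact Submodule.add_mem_sup (Ideal.mul_mem_right _ _ (Ideal.mem_span_singleton_self _))
      (Ideal.mem_map_of_mem _ hg)
  · rw [Ideal.span_singleton_le_iff_mem, RingHom.mem_ker, AlgHom.comp_apply,
      constantCoeffHom_apply, constantCoeff_X, map_zero]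
  · rwa [Ideal.mem_comap, RingHom.mem_ker, AlgHom.comp_apply, constantCoeffHom_apply,
      constantCoeff_C]

variable (M : ℕ) [NeZero M]

/-- The value at the origin of a function on the curve `Y² = X^M`. -/
noncomputable def evalOrigin : DoubleCover K M →ₐ[K] K where
  toFun z := constantCoeff z.re
  map_one' := map_one _
  map_mul' z w := by
    simp [QuadraticAlgebra.re_mul, NeZero.ne M]
  map_zero' := map_zero _
  map_add' _ _ := map_add _ _ _
  commutes' _ := constantCoeff_C _

theorem evalOrigin_apply (z : DoubleCover K M) : evalOrigin K M z = constantCoeff z.re :=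
  rfl

theorem evalOrigin_comp_doubleCoverResidue : (evalOrigin K M).comp (doubleCoverResidue K M) =
    (constantCoeffHom K K).comp (constantCoeffHom K K⟦X⟧) := by
  ext f
  obtain ⟨q, hq⟩ := exists_eq_C_add_C_mul_X_add K M f
  have h := congrArg (fun g => constantCoeff (constantCoeff g)) hq
  simpa [evalOrigin_apply, constantCoeffHom_apply, NeZero.ne M] using h.symm

/-- The restriction of power series in `X`, `Y`, `Z` to the curve `Y² = X^M` in the plane
`Z = 0`. -/
noncomputable def curveRestriction : K⟦X⟧⟦X⟧⟦X⟧ →ₐ[K] DoubleCover K M :=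
  (doubleCoverResidue K M).comp (constantCoeffHom K K⟦X⟧⟦X⟧)

/-- The restriction of power series in `X`, `Y`, `Z` to the line `X = Y = 0`. -/
noncomputable def lineRestriction : K⟦X⟧⟦X⟧⟦X⟧ →ₐ[K] K⟦X⟧ :=
  mapAlgHom ((evalOrigin K M).comp (doubleCoverResidue K M))

theorem curveRestriction_surjective : Function.Surjective (curveRestriction K M) := fun z =>
  let ⟨f, hf⟩ := doubleCoverResidue_surjective K M z
  ⟨C f, hf⟩

theorem lineRestriction_surjective : Function.Surjective (lineRestriction K M) :=
  fun g => ⟨_, mapAlgHom_map_algebraMap _ g⟩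

theorem ker_curveRestriction_inf_ker_lineRestriction :
    RingHom.ker (curveRestriction K M) ⊓ RingHom.ker (lineRestriction K M) =
      (idealAVeeL K (M - 1)).map (spaceEquiv K : MvPowerSeries (Fin 3) K →+* K⟦X⟧⟦X⟧⟦X⟧) := by
  have hker : RingHom.ker ((evalOrigin K M).comp (doubleCoverResidue K M)) =
      Ideal.span {C X, X} := by
    rw [evalOrigin_comp_doubleCoverResidue, ker_comp_constantCoeffHom, ker_constantCoeffHom,
      Ideal.map_span, Set.image_singleton, sup_comm, Ideal.span_insert]
  have hle : RingHom.ker (doubleCoverResidue K M) ≤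
      RingHom.ker ((evalOrigin K M).comp (doubleCoverResidue K M)) :=
    fun f hf => (congrArg (evalOrigin K M) hf).trans (map_zero _)
  rw [curveRestriction, lineRestriction, ker_inf_ker_mapAlgHom hle (IsNoetherian.noetherian _),
    hker, ker_doubleCoverResidue, idealAVeeL, maximalMinors_eq_span, ← pow_succ,
    Nat.sub_add_cancel (NeZero.one_le : 1 ≤ M)]
  simp only [Ideal.map_span, Set.image_singleton, RingHom.coe_coe, map_sub, map_mul, map_pow,
    spaceEquiv_X_zero, spaceEquiv_X_one, spaceEquiv_X_two, Ideal.span_insert, Ideal.map_sup,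
    Ideal.mul_sup, Ideal.span_singleton_mul_span_singleton]
  rw [sup_comm, sup_assoc]

theorem ker_curveRestriction_sup_ker_lineRestriction :
    RingHom.ker (curveRestriction K M) ⊔ RingHom.ker (lineRestriction K M) =
      RingHom.ker ((evalOrigin K M).comp (curveRestriction K M)) :=
  ker_sup_ker_mapAlgHom fun _ hf => (congrArg (evalOrigin K M) hf).trans (map_zero _)

theorem mem_range_curveRestriction_prod_lineRestriction {x : DoubleCoverLine K M} :
    x ∈ ((curveRestriction K M).prod (lineRestriction K M)).range ↔
      constantCoeff x.1.re = constantCoeff x.2 :=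
  mem_range_prod_mapAlgHom (doubleCoverResidue_surjective K M)

/-- `I` is the ideal of the curve `Y² = X^M` in the plane `Z = 0`, and `J` that of the line
`X = Y = 0`. -/
theorem exists_inf_eq_idealAVeeL : ∃ I J : Ideal (MvPowerSeries (Fin 3) K),
    I ⊓ J = idealAVeeL K (M - 1) ∧
    Nonempty ((MvPowerSeries (Fin 3) K ⧸ I) ≃ₐ[K] TypeARing K (M - 1)) ∧
    Nonempty ((MvPowerSeries (Fin 3) K ⧸ J) ≃ₐ[K] K⟦X⟧) ∧
    I ⊔ J = IsLocalRing.maximalIdeal (MvPowerSeries (Fin 3) K) := by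
  let e : MvPowerSeries (Fin 3) K ≃+* K⟦X⟧⟦X⟧⟦X⟧ := spaceEquiv K
  have quotientEquiv {B : Type _} [CommRing B] [Algebra K B] {f : K⟦X⟧⟦X⟧⟦X⟧ →ₐ[K] B}
      (hf : Function.Surjective f) :
      Nonempty ((MvPowerSeries (Fin 3) K ⧸ (RingHom.ker f).comap e) ≃ₐ[K] B) :=
    ⟨(Ideal.quotientEquivAlg _ _ (spaceEquiv K)
      (Ideal.map_comap_of_surjective _ e.surjective _).symm).trans
      (Ideal.quotientKerAlgEquivOfSurjective hf)⟩
  refine ⟨(RingHom.ker (curveRestriction K M)).comap e,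
    (RingHom.ker (lineRestriction K M)).comap e, ?_,
    (quotientEquiv (curveRestriction_surjective K M)).map (·.trans (typeARingEquiv K M).symm),
    quotientEquiv (lineRestriction_surjective K M), ?_⟩
  · rw [← Ideal.comap_inf, ker_curveRestriction_inf_ker_lineRestriction]
    exact Ideal.comap_map_of_bijective _ e.bijective
  · have hmax : (RingHom.ker ((evalOrigin K M).comp (curveRestriction K M))).IsMaximal :=
      RingHom.ker_isMaximal_of_surjective _ fun c => ⟨algebraMap K _ c, AlgHom.commutes _ c⟩
    rw [← Ideal.map_symm, ← Ideal.map_symm, ← Ideal.map_sup,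
      ker_curveRestriction_sup_ker_lineRestriction]
    exact IsLocalRing.eq_maximalIdeal (Ideal.map_isMaximal_of_equiv e.symm)

variable (m l : ℕ)

/-- The isomorphism of the ring of a singularity of type `A ∨ L` with `spatialUnion`. -/
noncomputable def typeAVeeLRingEquiv :
    (MvPowerSeries (Fin 3) K ⧸ idealAVeeL K (2 * (l + 1) + m - 1)) ≃ₐ[K] spatialUnion K m l :=
  haveI : NeZero (2 * (l + 1) + m) := ⟨by omega⟩
  quotientEquivOfRangeEqComap (spaceEquiv K)
    ((ker_algHom_prod _ _).trans (ker_curveRestriction_inf_ker_lineRestriction K _))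
    (scaleDoubleCoverLine_injective K m (l + 1))
    (by
      ext x
      exact (mem_range_curveRestriction_prod_lineRestriction K _).trans
        scaleDoubleCoverLine_mem_spatialUnion.symm)
    (range_scaleDoubleCoverLine K m (l + 1) ▸ spatialUnion_le_disjointUnion K m l)

end SpatialPresentation

section RegularRings

theorem isRegularLocalRing_localization_comap {R S : Type*} [CommRing R] [CommRing S]
    [IsRegularRing S] {f : R →+* S} (hf : Function.Surjective f) {e : R} (he : IsIdempotentElem e)
    (hker : ∀ x y, f x = f y ↔ e * x = e * y) (p : Ideal S) [p.IsPrime] :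
    IsRegularLocalRing (Localization.AtPrime (p.comap f)) := by
  let := f.toAlgebra
  have : IsLocalization.Away e S := IsLocalization.away_of_isIdempotentElem_of_mul he hker hf
  have : IsLocalization.AtPrime (Localization.AtPrime p) (p.comap f) :=
    IsLocalization.isLocalization_isLocalization_atPrime_isLocalization (Submonoid.powers e)
      (Localization.AtPrime p) p
  exact IsRegularLocalRing.of_ringEquiv
    (IsLocalization.algEquiv (p.comap f).primeCompl (Localization.AtPrime p)
      (Localization.AtPrime (p.comap f))).toRingEquiv

instance isRegularRing_prod (R S : Type*) [CommRing R] [CommRing S] [IsRegularRing R]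
    [IsRegularRing S] : IsRegularRing (R × S) := by
  rw [isRegularRing_iff]
  intro q hq
  rcases (Ideal.ideal_prod_prime q).1 hq with ⟨p, hp, h⟩ | ⟨p, hp, h⟩
  · obtain rfl : q = p.comap (RingHom.fst R S) := by
      ext x
      simp [h, Ideal.mem_prod]
    exact isRegularLocalRing_localization_comap Prod.fst_surjective (e := (1, 0))
      (by ext <;> simp) (fun x y => by simp [Prod.ext_iff]) p
  · obtain rfl : q = p.comap (RingHom.snd R S) := by
      ext x
      simp [h, Ideal.mem_prod]
    exact isRegularLocalRing_localization_comap Prod.snd_surjective (e := (0, 1))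
      (by ext <;> simp) (fun x y => by simp [Prod.ext_iff]) p

/-- If `2` is invertible, then `ω² = 1` splits as `ω = ± 1`. -/
def splitQuadraticAlgebraEquiv (R : Type*) [CommRing R] [Invertible (2 : R)] :
    QuadraticAlgebra R 1 0 ≃+* R × R where
  toFun z := (z.re + z.im, z.re - z.im)
  invFun w := ⟨⅟2 * (w.1 + w.2), ⅟2 * (w.1 - w.2)⟩
  left_inv z := QuadraticAlgebra.ext
    (by linear_combination z.re * invOf_mul_self (2 : R))
    (by linear_combination z.im * invOf_mul_self (2 : R))
  right_inv w := Prod.ext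
    (by linear_combination w.1 * invOf_mul_self (2 : R))
    (by linear_combination w.2 * invOf_mul_self (2 : R))
  map_mul' z w := Prod.ext
    (by simp only [QuadraticAlgebra.re_mul, QuadraticAlgebra.im_mul, Prod.fst_mul]; ring)
    (by simp only [QuadraticAlgebra.re_mul, QuadraticAlgebra.im_mul, Prod.snd_mul]; ring)
  map_add' z w := Prod.ext
    (by simp only [QuadraticAlgebra.re_add, QuadraticAlgebra.im_add, Prod.fst_add]; ring)
    (by simp only [QuadraticAlgebra.re_add, QuadraticAlgebra.im_add, Prod.snd_add]; ring)

open PowerSeries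

variable {K : Type*} [Field K]

theorem isRegularRing_doubleCover_zero [NeZero (2 : K)] : IsRegularRing (DoubleCover K 0) := by
  have two_unit : IsUnit (2 : K⟦X⟧) := by
    rw [isUnit_iff_constantCoeff, map_ofNat]
    exact (NeZero.ne (2 : K)).isUnit
  let := two_unit.invertible
  change IsRegularRing (QuadraticAlgebra K⟦X⟧ (X ^ 0) 0)
  rw [pow_zero]
  exact IsRegularRing.of_ringEquiv (splitQuadraticAlgebraEquiv K⟦X⟧).symm

theorem isUnit_doubleCover_one_iff {z : DoubleCover K 1} :
    IsUnit z ↔ constantCoeff z.re ≠ 0 := by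
  simp [isUnit_doubleCover_iff]

instance isLocalRing_doubleCover_one : IsLocalRing (DoubleCover K 1) := by
  refine IsLocalRing.of_nonunits_add fun a b ha hb => ?_
  rw [mem_nonunits_iff, isUnit_doubleCover_one_iff, not_not] at ha hb ⊢
  rw [QuadraticAlgebra.re_add, map_add, ha, hb, add_zero]

theorem eq_zero_of_norm_doubleCover_one_eq_zero {z : DoubleCover K 1}
    (hz : QuadraticAlgebra.norm z = 0) : z = 0 := by
  have hsq : z.re * z.re = X * (z.im * z.im) := by
    rw [QuadraticAlgebra.norm_def] at hz
    linear_combination hz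
  have him : z.im = 0 := by
    by_contra him
    have hre : z.re ≠ 0 := by
      rintro hre
      rw [hre, mul_zero, eq_comm] at hsq
      exact mul_ne_zero X_ne_zero (mul_ne_zero him him) hsq
    have horder := congrArg order hsq
    rw [order_mul, order_mul, order_mul, order_X, ← coe_toNat_order him,
      ← coe_toNat_order hre] at horder
    norm_cast at horder
    omega
  rw [him, mul_zero, mul_zero, mul_self_eq_zero] at hsq
  exact QuadraticAlgebra.ext hsq him

instance isDomain_doubleCover_one : IsDomain (DoubleCover K 1) := by
  have : NoZeroDivisors (DoubleCover K 1) := ⟨fun {a b} hab => by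
    have hnorm := congrArg QuadraticAlgebra.norm hab
    rw [map_mul, QuadraticAlgebra.norm_zero, mul_eq_zero] at hnorm
    exact hnorm.imp eq_zero_of_norm_doubleCover_one_eq_zero
      eq_zero_of_norm_doubleCover_one_eq_zero⟩
  exact NoZeroDivisors.to_isDomain _

theorem maximalIdeal_doubleCover_one :
    IsLocalRing.maximalIdeal (DoubleCover K 1) = Ideal.span {QuadraticAlgebra.omega} := by
  ext z
  rw [IsLocalRing.mem_maximalIdeal, mem_nonunits_iff, isUnit_doubleCover_one_iff, not_not,
    ← X_dvd_iff, Ideal.mem_span_singleton]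
  constructor
  · rintro ⟨a, ha⟩
    refine ⟨⟨z.im, a⟩, QuadraticAlgebra.ext ?_ ?_⟩ <;> simp [ha]
  · rintro ⟨w, rfl⟩
    simp

theorem isRegularRing_doubleCover_one : IsRegularRing (DoubleCover K 1) := by
  have : IsNoetherianRing (DoubleCover K 1) := IsNoetherianRing.of_finite K⟦X⟧ _
  have : IsDedekindDomain (DoubleCover K 1) :=
    ((tfae_of_isNoetherianRing_of_isLocalRing_of_isDomain (DoubleCover K 1)).out 4 2).1
      (show (IsLocalRing.maximalIdeal (DoubleCover K 1)).IsPrincipal from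
        ⟨_, maximalIdeal_doubleCover_one⟩)
  infer_instance

theorem isRegularRing_doubleCoverLine [NeZero (2 : K)] {m : ℕ} (hm : m ≤ 1) :
    IsRegularRing (DoubleCoverLine K m) := by
  have : IsRegularRing (DoubleCover K m) := by
    rcases Nat.le_one_iff_eq_zero_or_eq_one.1 hm with rfl | rfl
    · exact isRegularRing_doubleCover_zero
    · exact isRegularRing_doubleCover_one
  exact isRegularRing_prod _ _

end RegularRings

section SpatialUnionCoordinates

open PowerSeries

namespace spatialUnion

section Coordinates

variable (K : Type*) [CommRing K] (m l : ℕ)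

/-- The first coordinate on 3-space: the parameter of the base line of the curve. -/
noncomputable def x : spatialUnion K m l :=
  ⟨(⟨X, 0⟩, 0), dvd_zero _, by simp⟩

/-- The second coordinate on 3-space: the function `X^(l+1) ω` on the curve. -/
noncomputable def y : spatialUnion K m l :=
  ⟨(⟨0, X ^ (l + 1)⟩, 0), dvd_rfl, by simp⟩

/-- The third coordinate on 3-space: the parameter of the line. -/
noncomputable def z : spatialUnion K m l :=
  ⟨(0, X), dvd_zero _, by simp [QuadraticAlgebra.re_zero]⟩

end Coordinates

variable {K : Type*} [CommRing K] {m l : ℕ}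

theorem val_ext {r s : spatialUnion K m l} (hre : r.1.1.re = s.1.1.re)
    (him : r.1.1.im = s.1.1.im) (hsnd : r.1.2 = s.1.2) : r = s :=
  Subtype.ext (Prod.ext (QuadraticAlgebra.ext hre him) hsnd)

theorem val_mul_x_add_mul_y (a b : spatialUnion K m l) :
    (a * x K m l + b * y K m l).1 = (⟨a.1.1.re * X + X ^ m * b.1.1.im * X ^ (l + 1),
      a.1.1.im * X + b.1.1.re * X ^ (l + 1)⟩, 0) := by
  refine Prod.ext (QuadraticAlgebra.ext ?_ ?_) ?_ <;> simp [x, y]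

theorem mem_span_x_y {r : spatialUnion K m l} :
    r ∈ Ideal.span {x K m l, y K m l} ↔ r.1.2 = 0 := by
  rw [Ideal.mem_span_pair]
  constructor
  · rintro ⟨a, b, rfl⟩
    rw [val_mul_x_add_mul_y]
  · intro hr
    obtain ⟨⟨b, hb⟩, hconst⟩ := r.2
    rw [hr, map_zero] at hconst
    obtain ⟨a, ha⟩ := X_dvd_iff.2 hconst
    let scalar (f : K⟦X⟧) : spatialUnion K m l :=
      ⟨(⟨f, 0⟩, C (constantCoeff f)), dvd_zero _, (constantCoeff_C _).symm⟩
    refine ⟨scalar a, scalar b, Subtype.ext ?_⟩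
    rw [val_mul_x_add_mul_y]
    refine Prod.ext (QuadraticAlgebra.ext ?_ ?_) hr.symm
    · simp only [scalar, mul_zero, zero_mul, add_zero, ha, mul_comm X]
    · simp only [scalar, zero_mul, zero_add, hb, mul_comm b]

theorem mem_span_z_sup_span_x_y {r : spatialUnion K m l} (hr : X ∣ r.1.1.re) :
    r ∈ Ideal.span {z K m l} ⊔ Ideal.span {x K m l, y K m l} := by
  obtain ⟨g, hg⟩ : X ∣ r.1.2 := by rwa [X_dvd_iff, ← r.2.2, ← X_dvd_iff]
  let c : spatialUnion K m l := ⟨(⟨C (constantCoeff g), 0⟩, g), dvd_zero _, constantCoeff_C _⟩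
  rw [← add_sub_cancel (c * z K m l) r]
  refine Submodule.add_mem_sup (Ideal.mem_span_singleton'.2 ⟨c, rfl⟩) (mem_span_x_y.2 ?_)
  simp [c, z, hg, mul_comm]

theorem eq_zero_of_mul_x_add_mul_y_eq_zero {a b : spatialUnion K m l}
    (hab : a * x K m l + b * y K m l = 0) :
    a.1.1.re * X + X ^ m * b.1.1.im * X ^ (l + 1) = 0 ∧
      a.1.1.im * X + b.1.1.re * X ^ (l + 1) = 0 := by
  have hval := (val_mul_x_add_mul_y a b).symm.trans (congrArg Subtype.val hab)
  exact ⟨congrArg (·.1.re) hval, congrArg (·.1.im) hval⟩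

theorem exists_mul_y_add_mul_eq_zero : ∃ y' : spatialUnion K m l, ∀ a b,
    a * x K m l + b * y K m l = 0 → a * y K m l + b * y' = 0 := by
  refine ⟨⟨(⟨X ^ (2 * l + 1 + m), 0⟩, 0), dvd_zero _, by simp⟩, fun a b hab => ?_⟩
  obtain ⟨hre, him⟩ := eq_zero_of_mul_x_add_mul_y_eq_zero hab
  refine val_ext ?_ ?_ ?_
  · simp only [y, AddMemClass.coe_add, MulMemClass.coe_mul, ZeroMemClass.coe_zero, Prod.fst_add,
      Prod.fst_mul, Prod.fst_zero, QuadraticAlgebra.re_add, QuadraticAlgebra.re_mul,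
      QuadraticAlgebra.re_zero, mul_zero, zero_add, add_zero]
    linear_combination X ^ (m + l) * him
  · simp only [y, AddMemClass.coe_add, MulMemClass.coe_mul, ZeroMemClass.coe_zero, Prod.fst_add,
      Prod.fst_mul, Prod.fst_zero, QuadraticAlgebra.im_add, QuadraticAlgebra.im_mul,
      QuadraticAlgebra.im_zero, mul_zero, add_zero, zero_mul, zero_add]
    linear_combination X ^ l * hre
  · simp [y]

theorem not_x_dvd_y [Nontrivial K] : ¬ x K m l ∣ y K m l := by
  rintro ⟨r, hr⟩
  obtain ⟨b, hb⟩ := r.2.1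
  have him : X ^ (l + 1) = X * r.1.1.im := by
    simpa [x, y] using congrArg (fun t : spatialUnion K m l => t.1.1.im) hr
  rw [hb, ← mul_assoc, ← pow_succ'] at him
  have hcoeff := X_pow_dvd_iff.1 ⟨b, him⟩ (l + 1) (by omega)
  simp at hcoeff

variable [IsDomain K]

theorem mul_z_eq_zero_iff {r : spatialUnion K m l} : r * z K m l = 0 ↔ r.1.2 = 0 := by
  rw [← Subtype.coe_inj]
  simp [z, Prod.ext_iff, X_ne_zero]

theorem disjoint_span_z_span_x_y :
    Disjoint (Ideal.span {z K m l}) (Ideal.span {x K m l, y K m l}) := by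
  rw [Submodule.disjoint_def]
  intro r hr hr'
  obtain ⟨c, rfl⟩ := Ideal.mem_span_singleton'.1 hr
  rw [mem_span_x_y] at hr'
  rw [mul_z_eq_zero_iff]
  exact (mul_eq_zero_iff_right X_ne_zero).1 hr'

theorem X_dvd_re_of_mul_x_add_mul_y_eq_zero {a b : spatialUnion K m l}
    (hab : a * x K m l + b * y K m l = 0) : X ∣ a.1.1.re := by
  obtain ⟨w, hw⟩ := b.2.1
  have hre := (eq_zero_of_mul_x_add_mul_y_eq_zero hab).1
  rw [hw] at hre
  exact ⟨-(X ^ (m + 2 * l) * w), mul_right_cancel₀ X_ne_zero (by linear_combination hre)⟩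

end spatialUnion

open spatialUnion in
theorem not_isGorensteinLocalRing_of_ringEquiv_spatialUnion {K : Type*} [CommRing K] [IsDomain K]
    {m l : ℕ} {R : Type u} [CommRing R] (e : R ≃+* spatialUnion K m l) :
    ¬ IsGorensteinLocalRing R := by
  rintro ⟨-, -, d, hd⟩
  obtain ⟨y', hy'⟩ := exists_mul_y_add_mul_eq_zero (K := K) (m := m) (l := l)
  exact not_hasInjectiveDimensionLE_of_ringEquiv e
    (fun r => mul_z_eq_zero_iff.trans mem_span_x_y.symm) disjoint_span_z_span_x_y
    (fun a b hab => mem_span_z_sup_span_x_y (X_dvd_re_of_mul_x_add_mul_y_eq_zero hab))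
    hy' not_x_dvd_y d hd

end SpatialUnionCoordinates

section LocalRings

open PowerSeries

variable {K : Type*} [Field K] {m l : ℕ}

instance isLocalRing_spatialUnion : IsLocalRing (spatialUnion K m l) :=
  .of_surjective' ((typeAVeeLRingEquiv K m l).toRingEquiv.toRingHom.comp (Ideal.Quotient.mk _))
    ((typeAVeeLRingEquiv K m l).surjective.comp Ideal.Quotient.mk_surjective)

instance isNoetherianRing_spatialUnion : IsNoetherianRing (spatialUnion K m l) :=
  isNoetherianRing_of_ringEquiv _ (typeAVeeLRingEquiv K m l).toRingEquiv

theorem isRegularRing_disjointUnion_zero [NeZero (2 : K)] (hm : m ≤ 1) :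
    IsRegularRing (disjointUnion K m 0) := by
  have := isRegularRing_doubleCoverLine (K := K) hm
  rw [disjointUnion_zero]
  exact IsRegularRing.of_ringEquiv (Subalgebra.topEquiv (R := K)).symm.toRingEquiv

/-- The isomorphism of `disjointUnion` with the product of the ring of a singularity of type `A`
and that of a line. -/
noncomputable def disjointUnionEquivTypeARing (K : Type*) [Field K] (m l : ℕ) [NeZero (2 * l + m)] :
    disjointUnion K m l ≃ₐ[K] TypeARing K (2 * l + m - 1) × K⟦X⟧ :=
  (disjointUnionEquiv K m l).trans
    (AlgEquiv.prodCongr (typeARingEquiv K (2 * l + m)).symm AlgEquiv.refl)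

end LocalRings

theorem mainTheorem7_general {K : Type*} [Field K] [NeZero (2 : K)] {A : Type u} [CommRing A]
    [Algebra K A] (n : ℕ) (hn : 4 ≤ n) (hA : Nonempty (A ≃ₐ[K] TypeDRing K n)) :
    let A' : Subalgebra A (FractionRing A) := primeRing ⊥
    let A'' : Subalgebra A (FractionRing A) := primeRing A'
    Nonempty (A' ≃ₐ[K] MvPowerSeries (Fin 3) K ⧸ idealAVeeL K (n - 3)) ∧
    (∃ I J : Ideal (MvPowerSeries (Fin 3) K),
      Nonempty (A' ≃ₐ[K] MvPowerSeries (Fin 3) K ⧸ (I ⊓ J)) ∧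
      Nonempty ((MvPowerSeries (Fin 3) K ⧸ I) ≃ₐ[K] TypeARing K (n - 3)) ∧
      Nonempty ((MvPowerSeries (Fin 3) K ⧸ J) ≃ₐ[K] PowerSeries K) ∧
      I ⊔ J = IsLocalRing.maximalIdeal (MvPowerSeries (Fin 3) K)) ∧
    (IsLocalRing A' ∧ IsNoetherianRing A' ∧ ¬ IsGorensteinLocalRing A') ∧
    (6 ≤ n → Nonempty (A'' ≃ₐ[K] TypeARing K (n - 5) × PowerSeries K)) ∧
    ((n = 4 ∨ n = 5) → IsRegularRing A'') ∧
    numNormSteps A = n / 2 := by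
  intro A' A''
  obtain ⟨m, l, hm, rfl⟩ : ∃ m l, m ≤ 1 ∧ n = 2 * (l + 1) + m + 2 :=
    ⟨n % 2, n / 2 - 2, by omega, by omega⟩
  obtain ⟨e⟩ := hA
  obtain ⟨⟨e₁⟩, ⟨e₂⟩, hsteps⟩ :=
    normalization_of_algEquiv_planarUnion hm (e.trans (typeDRingEquiv K m l))
  rw [show 2 * (l + 1) + m + 2 - 3 = 2 * (l + 1) + m - 1 by omega,
    show 2 * (l + 1) + m + 2 - 5 = 2 * l + m - 1 by omega]
  have : NeZero (2 * (l + 1) + m) := ⟨by omega⟩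
  have hAVeeL : Nonempty (A' ≃ₐ[K] _) := ⟨e₁.trans (typeAVeeLRingEquiv K m l).symm⟩
  obtain ⟨I, J, hinf, hI, hJ, hsup⟩ := exists_inf_eq_idealAVeeL K (2 * (l + 1) + m)
  refine ⟨hAVeeL, ⟨I, J, hinf ▸ hAVeeL, hI, hJ, hsup⟩, ⟨e₁.symm.toRingEquiv.isLocalRing,
    isNoetherianRing_of_ringEquiv _ e₁.symm.toRingEquiv,
    not_isGorensteinLocalRing_of_ringEquiv_spatialUnion e₁.toRingEquiv⟩, fun h6 => ?_,
    fun h45 => ?_, by omega⟩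
  · have : NeZero (2 * l + m) := ⟨by omega⟩
    exact ⟨e₂.trans (disjointUnionEquivTypeARing K m l)⟩
  · obtain rfl : l = 0 := by omega
    have := isRegularRing_disjointUnion_zero (K := K) hm
    exact IsRegularRing.of_ringEquiv e₂.symm.toRingEquiv

theorem mainTheorem7 {A : Type u} [CommRing A] [Algebra ℂ A] (n : ℕ) (hn : 4 ≤ n)
    (hA : IsTypeD n A) :
    let A' : Subalgebra A (FractionRing A) := primeRing ⊥
    let A'' : Subalgebra A (FractionRing A) := primeRing A'
    IsTypeAVeeL (n - 3) A' ∧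
    IsTransversalUnionALine (n - 3) A' ∧
    (IsLocalRing A' ∧ IsNoetherianRing A' ∧ ¬ IsGorensteinLocalRing A') ∧
    (6 ≤ n → Nonempty (A'' ≃ₐ[ℂ] SingA (n - 5) × PowerSeries ℂ)) ∧
    ((n = 4 ∨ n = 5) → IsRegularRing A'') ∧
    numNormSteps A = n / 2 :=
  mainTheorem7_general n hn hA
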